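/- \textbf{Setting.} Let $d\ge 3$; write $\|\cdot\|_1,\|\cdot\|_2,\|\cdot\|_\infty$ for the usual norms on $\mathbb R^d$ and $B_1(c,r)=\{x:\|x-c\|_1\le r\}$. Let $\Theta\subset\mathbb R^d$ be a compact convex parameter set (for instance $\Theta=B_1(\theta_0,R)$). Let $\mathcal Y\subset\mathbb R$ be a measurable label set, and let $(X,Y)$ be an $\mathbb R^d\times\mathcal Y$-valued random pair with law $P$ such that $\mathbb E\|X\|_2^4<\infty$, $\mathbb E\|YX\|_2^2<\infty$ and $\mathbb E|Y|^2<\infty$. Let $\ell:\mathbb R\times\mathbb R\to\mathbb R$ be a measurable loss and write $\ell'$ for its derivative in the first argument. Assume that for all $y\in\mathcal Y$ the map $\ell(\cdot,y)$ is convex and differentiable and, for constants $C_1,C_2,C_1',C_2',\gamma>0$ independent of $y$ and all $z,z'\in\mathbb R$, $|\ell(z,y)|\le C_1+C_2|z-y|^2$, $|\ell'(z,y)|\le C_1'+C_2'|z-y|$ and $|\ell'(z,y)-\ell'(z',y)|\le\gamma|z-z'|$. Put $\mathcal L(\theta)=\mathbb E\,\ell(\langle\theta,X\rangle,Y)$ and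 $g=\nabla\mathcal L$. Let $L>0$ satisfy $\|g(\theta)-g(\theta')\|_\infty\le L\|\theta-\theta'\|_1$ on $\Theta$. Let $\theta^\star\in\Theta$ minimize $\mathcal L$ over $\Theta$, have at most $s$ nonzero coordinates, and satisfy, for some $\kappa>0$, $\mathcal L(\theta)-\mathcal L(\theta^\star)\ge\kappa\|\theta-\theta^\star\|_2^2$ for all $\theta\in\Theta$. Let $\bar s\ge\max(s,1)$, $\theta_0\in\Theta$, $R>0$ with $\|\theta^\star-\theta_0\|_1\le R$, $0<\beta\le 1/L$, and let $K\ge1$ be an integer. Put $$\sigma_{\max}^2=\sup_{\theta\in\Theta}\max_{1\le j\le d}\operatorname{Var}\big(\ell'(\langle\theta,X\rangle,Y)X^j\big),$$ and assume $\sigma_{\max}>0$. \textbf{Data.} The sample $Z_i=(X_i,Y_i)$, $i\le n$, consists of inliers, i.i.d. with law $P$, and of arbitrary outliers. It contains $T$ pairwise disjoint batches of even size $\widetilde n>0$ (e.g. $\widetilde n=n/T$). For some $\eta\ge0$, each batch contains at most $\eta\widetilde n$ outliers, and the inliers of each batch are jointly independent of all data (outliers included) of the previous batches. Let $\delta\in(0,1)$,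 $\widetilde\delta=\delta/T$, $$\alpha=8\eta+12\,\frac{\log(4/\widetilde\delta)+\log d}{\widetilde n},\qquad \bar\epsilon=7\sigma_{\max}\sqrt{4\eta+6\,\frac{\log(4/\widetilde\delta)+\log d}{\widetilde n}},$$ and assume $\alpha\le\frac12$. \textbf{Gradient estimator.} For reals $x_1,\dots,x_m$ with $m$ even, let $x^{(1)}\le\dots\le x^{(m/2)}$ be the order statistics of $x_1,\dots,x_{m/2}$, let $q_a=x^{(\lfloor am/2\rfloor)}$, and let $\mathtt{TM}_\alpha(x_1,\dots,x_m)=\frac2m\sum_{i=m/2+1}^m\min(\max(q_\alpha,x_i),q_{1-\alpha})$. At the $i$-th iteration, $\widehat g(\theta)$ has $j$-th coordinate $\mathtt{TM}_\alpha$ of the numbers $\ell'(\langle\theta,X\rangle,Y)X^j$ over the pairs $(X,Y)$ of the $i$-th batch. \textbf{Algorithm (AMMD).} Let $p=1+1/\log d$, $\omega(\theta)=\frac12e\log(d)\,d^{(p-1)(2-p)/p}\|\theta\|_p^2$, $\nu=\frac12e^2\log d$, $\omega_{c}(\theta)=\omega(\theta-c)$ and $V_{c}(\theta,\theta')=\omega_{c}(\theta)-\omega_{c}(\theta')-\langle\nabla\omega_{c}(\theta'),\theta-\theta'\rangle$.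 Set $\theta^{(0)}=\theta_0$ and $R_0=R$. For $k=1,\dots,K$: let $\theta^{(k)}_0=\theta^{(k-1)}$, $\Theta_k=\Theta\cap B_1(\theta^{(k-1)},R_{k-1})$, $T_k=\lceil\nu R_{k-1}/(\beta\bar\epsilon)\rceil$; for $0\le t<T_k$ let $$\theta^{(k)}_{t+1}=\operatorname*{arg\,min}_{\theta'\in\Theta_k}\Big\{\langle\beta\,\widehat g(\theta^{(k)}_t),\theta'\rangle+\beta\bar\epsilon\|\theta'-\theta^{(k)}_t\|_1+V_{\theta^{(k)}_0}(\theta',\theta^{(k)}_t)\Big\},$$ with a new batch at each iteration; let $\theta^{(k)}$ be a closest point (in $\|\cdot\|_2$) to $\theta^{(k)}_{T_k}$ among the elements of $\Theta$ with at most $\bar s$ nonzero coordinates; and let $R_k=\frac12\big(R_{k-1}+40\bar s\bar\epsilon/\kappa\big)$. Every iterate is taken to be a measurable function of the batches used before it (this only concerns how ties are broken). The total number of iterations is assumed to be at most the number of batches, $\sum_{k=1}^KT_k\le T$ (for instance $T=\sum_{k=1}^KT_k$). The output is $\widehat\theta=\theta^{(K)}$. \textbf{Claim.} With probability at least $1-\delta$,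 $$\big\|\widehat\theta-\theta^\star\big\|_2\le\frac{2^{-K/2}R}{\sqrt{\bar s}}+\frac{140\sqrt{2\bar s}\,\sigma_{\max}}{\kappa}\sqrt{4\eta+6\,\frac{\log(4/\widetilde\delta)+\log d}{\widetilde n}}.$$ -/

import Mathlib

open MeasureTheory ProbabilityTheory

noncomputable section

namespace SparseMD

/-- The parameter and covariate space `ℝ^d`; its norm is the Euclidean norm. -/
abbrev E (d : ℕ) : Type := EuclideanSpace ℝ (Fin d)

/-! ### Norms, sparsity, balls -/

/-- The `ℓ¹` norm. -/
def l1Norm {d : ℕ} (x : E d) : ℝ := ∑ j, |x j|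

/-- The `ℓ^∞` norm, dual to the `ℓ¹` norm. -/
def linftyNorm {d : ℕ} (x : E d) : ℝ := ⨆ j, |x j|

/-- The `ℓ^p` norm for a real exponent `p`. -/
def lpNorm {d : ℕ} (p : ℝ) (x : E d) : ℝ := (∑ j, |x j| ^ p) ^ (1 / p)

/-- The number of nonzero coordinates. -/
def sparsity {d : ℕ} (x : E d) : ℕ := (Finset.univ.filter fun j => x j ≠ 0).card

/-- The closed `ℓ¹` ball. -/
def l1Ball {d : ℕ} (c : E d) (R : ℝ) : Set (E d) := {x | l1Norm (x - c) ≤ R}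

/-- `y` is a closest (in Euclidean distance) `sbar`-sparse element of `Θ` to `x`. -/
def IsSparsification {d : ℕ} (Θ : Set (E d)) (sbar : ℕ) (x y : E d) : Prop :=
  y ∈ Θ ∧ sparsity y ≤ sbar ∧ ∀ z ∈ Θ, sparsity z ≤ sbar → ‖y - x‖ ≤ ‖z - x‖

/-! ### Distance generating function and proximal operator -/

/-- The exponent `p = 1 + 1 / log d`. -/
def dgfExponent (d : ℕ) : ℝ := 1 + 1 / Real.log d

/-- The distance generating function
`ω(θ) = (1/2) e log(d) d^((p-1)(2-p)/p) ‖θ‖_p ^ 2` with `p = 1 + 1 / log d`. -/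
def dgf {d : ℕ} (θ : E d) : ℝ :=
  1 / 2 * Real.exp 1 * Real.log d
    * (d : ℝ) ^ ((dgfExponent d - 1) * (2 - dgfExponent d) / dgfExponent d)
    * lpNorm (dgfExponent d) θ ^ 2

/-- The quadratic growth constant `ν = (1/2) e² log d` of `dgf` with respect to the `ℓ¹` norm. -/
def dgfGrowth (d : ℕ) : ℝ := 1 / 2 * Real.exp 1 ^ 2 * Real.log d

/-- The Bregman divergence `V_{θ₀}(θ, θ')` of `θ ↦ ω(θ - θ₀)`. -/
def bregman {d : ℕ} (θ₀ θ θ' : E d) : ℝ :=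
  dgf (θ - θ₀) - dgf (θ' - θ₀) - inner ℝ (gradient (fun φ => dgf (φ - θ₀)) θ') (θ - θ')

/-- `θ'` is the value of the corrected proximal operator over the domain `D`, i.e. it minimizes
`φ ↦ ⟨β u, φ⟩ + β ε ‖φ - θ‖₁ + V_{θ₀}(φ, θ)` over `D`. -/
def IsCorrectedProx {d : ℕ} (β ε : ℝ) (u θ θ₀ : E d) (D : Set (E d)) (θ' : E d) : Prop :=
  θ' ∈ D ∧
    IsMinOn (fun φ => inner ℝ (β • u) φ + β * ε * l1Norm (φ - θ) + bregman θ₀ φ θ) D θ'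

/-! ### Approximate Multistage Mirror Descent -/

/-- The radii `R_0 = R`, `R_k = (R_{k-1} + 40 sbar ε / κ) / 2`. -/
def stageRadius (sbar : ℕ) (R κ ε : ℝ) : ℕ → ℝ
  | 0 => R
  | k + 1 => 1 / 2 * (stageRadius sbar R κ ε k + 40 * sbar * ε / κ)

/-- The number of steps of the stage of index `k` (stages are indexed from `0`):
`⌈ν R_k / (β ε)⌉`, where `R_k` is the radius used in that stage. -/
def stageLength (d sbar : ℕ) (R κ β ε : ℝ) (k : ℕ) : ℕ :=
  ⌈dgfGrowth d * stageRadius sbar R κ ε k / (β * ε)⌉₊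

/-- The number of iterations made before the stage of index `k`; for `k = K` this is the total
number of iterations of a run with `K` stages. -/
def stageStart (d sbar : ℕ) (R κ β ε : ℝ) (k : ℕ) : ℕ :=
  ∑ j ∈ Finset.range k, stageLength d sbar R κ β ε j

/-- `θ k t` are the inner iterates and `out k` the successive stage estimates (`out 0` being the
initial point) of a run of AMMD with `K` stages on the parameter set `Θ`, where `g i` is the
gradient estimator used at the `i`-th iteration overall. The stage of index `k` is run on the
part of `Θ` in the `ℓ¹` ball of radius `R_k` around `out k`. The output of the run is `out K`. -/
structure IsAMMDRun {d : ℕ} (Θ : Set (E d)) (θ₀ : E d) (sbar : ℕ) (R κ β ε : ℝ) (K : ℕ)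
    (g : ℕ → E d → E d) (θ : ℕ → ℕ → E d) (out : ℕ → E d) : Prop where
  init : out 0 = θ₀
  start : ∀ k < K, θ k 0 = out k
  step : ∀ k < K, ∀ t < stageLength d sbar R κ β ε k,
    IsCorrectedProx β ε (g (stageStart d sbar R κ β ε k + t) (θ k t)) (θ k t) (out k)
      (Θ ∩ l1Ball (out k) (stageRadius sbar R κ ε k)) (θ k (t + 1))
  sparsify : ∀ k < K,
    IsSparsification Θ sbar (θ k (stageLength d sbar R κ β ε k)) (out (k + 1))

/-! ### Coordinatewise trimmed mean -/

/-- The `k`-th smallest of the values `x i`, `i ∈ s` (for `1 ≤ k ≤ #s`): the least `v` such that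
at least `k` of these values are at most `v`. -/
def orderStat {ι : Type} (s : Finset ι) (x : ι → ℝ) (k : ℕ) : ℝ :=
  sInf {v : ℝ | k ≤ (s.filter fun i => x i ≤ v).card}

/-- The empirical quantile of level `a` of the first half of the sample. -/
def halfQuantile {m : ℕ} (x : Fin m → ℝ) (a : ℝ) : ℝ :=
  orderStat (Finset.univ.filter fun i : Fin m => (i : ℕ) < m / 2) x ⌊a * m / 2⌋₊

/-- The trimmed mean with parameter `α` of a sample of even size `m`: the values of the second half
are clipped at the quantiles of levels `α` and `1 - α` of the first half, then averaged. -/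
def trimmedMean {m : ℕ} (α : ℝ) (x : Fin m → ℝ) : ℝ :=
  2 / m * ∑ i ∈ Finset.univ.filter (fun i : Fin m => m / 2 ≤ (i : ℕ)),
    min (max (halfQuantile x α) (x i)) (halfQuantile x (1 - α))

/-! ### Statistical model -/

/-- The objective `L(θ) = 𝔼 ℓ(⟨θ, X⟩, Y)`, where `(X, Y)` has distribution `P`. -/
def objective {d : ℕ} (P : Measure (E d × ℝ)) (loss : ℝ → ℝ → ℝ) (θ : E d) : ℝ :=
  ∫ z, loss (inner ℝ θ z.1) z.2 ∂P

/-- The sample gradient `ℓ'(⟨θ, x⟩, y) x`, where `ℓ'` is the derivative in the first argument. -/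
def gradSample {d : ℕ} (loss : ℝ → ℝ → ℝ) (θ : E d) (z : E d × ℝ) : E d :=
  deriv (fun t => loss t z.2) (inner ℝ θ z.1) • z.1

/-- The coordinatewise trimmed mean of the sample gradients of a batch `z`. -/
def gradEstimate {d m : ℕ} (α : ℝ) (loss : ℝ → ℝ → ℝ) (z : Fin m → E d × ℝ) (θ : E d) : E d :=
  WithLp.toLp 2 fun j => trimmedMean α fun i => gradSample loss θ (z i) j

/-- `σ_max`, where `σ_max² = sup_{θ ∈ Θ} max_j Var(ℓ'(⟨θ, X⟩, Y) X^j)`. -/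
def sigmaMax {d : ℕ} (P : Measure (E d × ℝ)) (loss : ℝ → ℝ → ℝ) (Θ : Set (E d)) : ℝ :=
  Real.sqrt (sSup {v : ℝ | ∃ θ ∈ Θ, ∃ j : Fin d, v = variance (fun z => gradSample loss θ z j) P})

/-- Conditions on the loss, for labels in `labels`: growth conditions on the loss and
its derivative, convexity, differentiability and smoothness in the first argument. -/
structure IsAdmissibleLoss (labels : Set ℝ) (loss : ℝ → ℝ → ℝ) : Prop where
  measurable : Measurable (Function.uncurry loss)
  growth : ∃ C₁ > 0, ∃ C₂ > 0, ∀ z, ∀ y ∈ labels, |loss z y| ≤ C₁ + C₂ * |z - y| ^ 2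
  deriv_growth : ∃ C₁ > 0, ∃ C₂ > 0, ∀ z, ∀ y ∈ labels,
    |deriv (fun t => loss t y) z| ≤ C₁ + C₂ * |z - y|
  convex : ∀ y ∈ labels, ConvexOn ℝ Set.univ fun t => loss t y
  differentiable : ∀ y ∈ labels, Differentiable ℝ fun t => loss t y
  smooth : ∃ γ > 0, ∀ y ∈ labels, ∀ z z',
    |deriv (fun t => loss t y) z - deriv (fun t => loss t y) z'| ≤ γ * |z - z'|

/-- Conditions on the distribution `P` of `(X, Y)`: `Y` takes values in `labels`, and
`𝔼‖X‖⁴`, `𝔼‖Y X‖²`, `𝔼|Y|²` are finite. -/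
structure IsAdmissibleLaw {d : ℕ} (labels : Set ℝ) (P : Measure (E d × ℝ)) : Prop where
  prob : IsProbabilityMeasure P
  mem_labels : ∀ᵐ z ∂P, z.2 ∈ labels
  moment_X : Integrable (fun z : E d × ℝ => ‖z.1‖ ^ 4) P
  moment_YX : Integrable (fun z : E d × ℝ => ‖z.2 • z.1‖ ^ 2) P
  moment_Y : Integrable (fun z : E d × ℝ => |z.2| ^ 2) P

/-- The σ-algebra generated by the data of the batches of index `< t`. -/
@[reducible] def pastSigma {Ω : Type*} {d n m : ℕ} (Z : Fin n → Ω → E d × ℝ) (batch : ℕ → Fin m → Fin n)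
    (t : ℕ) : MeasurableSpace Ω :=
  ⨆ r : ℕ, ⨆ _ : r < t, ⨆ i : Fin m, MeasurableSpace.comap (Z (batch r i)) inferInstance

/-- The σ-algebra generated by the inliers of the batch of index `t`. -/
@[reducible] def inlierSigma {Ω : Type*} {d n m : ℕ} (Z : Fin n → Ω → E d × ℝ) (batch : ℕ → Fin m → Fin n)
    (O : Finset (Fin n)) (t : ℕ) : MeasurableSpace Ω :=
  ⨆ i : Fin m, ⨆ _ : batch t i ∉ O, MeasurableSpace.comap (Z (batch t i)) inferInstance

/-- A corrupted sample `Z_i = (X_i, Y_i)`, `i < n`, with set of outliers `O`, split into `T`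
pairwise disjoint batches of size `m`. The inliers are i.i.d. with distribution `P`. The outliers
are arbitrary (they may depend on one another and on the data), except that the inliers of a fresh
batch are independent of the data (outliers included) of the batches before it. Each batch contains
at most `η m` outliers. -/
structure IsSplitCorruptedSample {Ω : Type*} [MeasurableSpace Ω] (μ : Measure Ω) {d n m : ℕ}
    (P : Measure (E d × ℝ)) (Z : Fin n → Ω → E d × ℝ) (O : Finset (Fin n)) (T : ℕ)
    (batch : ℕ → Fin m → Fin n) (η : ℝ) : Prop where
  measurable : ∀ i, Measurable (Z i)
  inlier_law : ∀ i ∉ O, μ.map (Z i) = P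
  inlier_indep : iIndepFun (fun i : {i : Fin n // i ∉ O} => Z i) μ
  batch_disjoint : ∀ t < T, ∀ t' < T, ∀ i i', batch t i = batch t' i' → t = t' ∧ i = i'
  fresh : ∀ t < T, Indep (inlierSigma Z batch O t) (pastSigma Z batch t) μ
  corruption : ∀ t < T, ((Finset.univ.filter fun i => batch t i ∈ O).card : ℝ) ≤ η * m

end SparseMD

end

/-! The proof separates optimization from statistics.

Optimization. Suppose every gradient estimate is within `ε` of the true gradient, coordinatewise, at
the iterate where it is used. The function `dgf` is 1-strongly convex for the ℓ¹ norm, yet at most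
`dgfGrowth d * r ^ 2`, of order `log d`, on the ℓ¹ ball of radius `r`. In a proximal step, the
penalty `β ε ‖· - θ‖₁` absorbs the gradient error along the move actually made. Two things follow
(`IsCorrectedProx.progress`): against a comparison point `v` a step loses only `2 β ε ‖v - θ‖₁`,
and, taking `v = θ`, the objective never increases. Telescoping therefore controls the last iterate
of a stage without averaging: its excess is at most `5 ε r` (`stage_excess_le`).

By quadratic growth the squared Euclidean error is then at most `5 ε r / κ`. Sparsification at most
doubles the error, and a difference of two `sbar`-sparse vectors `x` has `‖x‖₁² ≤ 2 sbar ‖x‖²`.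
Hence the squared ℓ¹ error is at most `r * (40 sbar ε / κ)`, and by the arithmetic-geometric mean
inequality the next radius, half the sum of the two factors, bounds the error. The radii contract to
`40 sbar ε / κ` (`IsAMMDRun.norm_sub_le`).

Statistics. Fix a point, a coordinate and a sign, and let `F` be the centred signed coordinate of
the sample gradient, of variance at most `σ²`. Put `N = m / 2`, `h = η m`, so that `α N = 4 h + 6 Λ`
with `Λ = log (4 / δt) + log d`. Two levels govern the trimming: `B = 2 σ / √α`, rarely exceeded by
Chebyshev, and the level `b` at which the expected shortfall `𝔼 (b - F)₊` equals `3 √α σ`. Clipping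
below at `b` raises the mean by exactly this amount, while `F ≤ b` still has probability of order
`α` (`sq_div_le_measure_le`). Chernoff bounds show that, up to probability `2 exp (-Λ)`, the
empirical quantiles of the first half lie below `b` and `B` in spite of the outliers, and the
clipped sum over the second half is small (`measure_not_sideGood_le`). Each outlier adds at most
`B`. Both signs together bound the error of the trimmed mean by `13/3 √α σ ≤ ε`.

No uniformity over `Θ` is needed: an iterate depends on earlier batches only, so by independence and
Fubini the bound at fixed points passes to it (`measureReal_le_of_section_le`). A union bound over
two signs, `d` coordinates and at most `T` iterations gives the failure probability `4 d T exp (-Λ)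
= δ`. -/

namespace SparseMD

/-! ### Strong convexity of the squared `ℓ^p` norm -/

/-- Hölder's inequality with weights `u`. -/
lemma rpow_sum_abs_le_weighted {ι : Type*} [Fintype ι] {r : ℝ} (hr0 : 0 < r) (hr1 : r < 1)
    (h u : ι → ℝ) (hu : ∀ j, 0 < u j) :
    (∑ j, |h j| ^ (2 * r)) ^ (1 / r) ≤
      (∑ j, u j ^ r) ^ (1 / r - 1) * ∑ j, u j ^ (r - 1) * h j ^ 2 := by
  have hS : 0 ≤ ∑ j, u j ^ r := Finset.sum_nonneg fun j _ => Real.rpow_nonneg (hu j).le _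
  have hW : 0 ≤ ∑ j, u j ^ (r - 1) * h j ^ 2 :=
    Finset.sum_nonneg fun j _ => mul_nonneg (Real.rpow_nonneg (hu j).le _) (sq_nonneg _)
  have hpq : (1 / r).HolderConjugate (1 / (1 - r)) := by
    rw [Real.holderConjugate_iff]
    refine ⟨by rw [lt_div_iff₀ hr0]; linarith, ?_⟩
    simp
  have key := Real.inner_le_Lp_mul_Lq_of_nonneg Finset.univ hpq
    (f := fun j => (u j ^ (r - 1) * h j ^ 2) ^ r) (g := fun j => (u j ^ r) ^ (1 - r))
    (fun j _ => Real.rpow_nonneg (mul_nonneg (Real.rpow_nonneg (hu j).le _) (sq_nonneg _)) _)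
    (fun j _ => Real.rpow_nonneg (Real.rpow_nonneg (hu j).le _) _)
  have e1 : ∀ j, (u j ^ (r - 1) * h j ^ 2) ^ r * (u j ^ r) ^ (1 - r) = |h j| ^ (2 * r) := by
    intro j
    rw [Real.mul_rpow (Real.rpow_nonneg (hu j).le _) (sq_nonneg _), ← Real.rpow_mul (hu j).le,
      ← Real.rpow_mul (hu j).le, mul_right_comm, ← Real.rpow_add (hu j), ← sq_abs,
      ← Real.rpow_natCast, ← Real.rpow_mul (abs_nonneg _)]
    have : (r - 1) * r + r * (1 - r) = 0 := by ring
    rw [this]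
    simp
  have e2 : ∀ j, ((u j ^ (r - 1) * h j ^ 2) ^ r) ^ (1 / r) = u j ^ (r - 1) * h j ^ 2 := by
    intro j
    rw [← Real.rpow_mul (mul_nonneg (Real.rpow_nonneg (hu j).le _) (sq_nonneg _)),
      mul_one_div_cancel hr0.ne', Real.rpow_one]
  have e3 : ∀ j, ((u j ^ r) ^ (1 - r)) ^ (1 / (1 - r)) = u j ^ r := by
    intro j
    rw [← Real.rpow_mul (Real.rpow_nonneg (hu j).le _), mul_one_div_cancel (by linarith),
      Real.rpow_one]
  simp only [e1, e2, e3, one_div_one_div] at key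
  calc (∑ j, |h j| ^ (2 * r)) ^ (1 / r)
      ≤ ((∑ j, u j ^ (r - 1) * h j ^ 2) ^ r * (∑ j, u j ^ r) ^ (1 - r)) ^ (1 / r) :=
        Real.rpow_le_rpow (Finset.sum_nonneg fun j _ => Real.rpow_nonneg (abs_nonneg _) _) key
          (by positivity)
    _ = _ := by
        rw [Real.mul_rpow (Real.rpow_nonneg hW _) (Real.rpow_nonneg hS _), ← Real.rpow_mul hW,
          ← Real.rpow_mul hS, mul_one_div_cancel hr0.ne', Real.rpow_one, mul_comm]
        congr 2
        field_simp

/-- The shift `ε > 0` keeps the bases of the powers positive, so the function is twice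
differentiable and the claim is that its second derivative is nonnegative. With `S = ∑ u ^ r`, the
term containing `S' ^ 2` is nonnegative since `r < 1`; the one containing `S''` dominates `2 (2 r -
1) H` by the weighted Hölder inequality. -/
lemma convexOn_smoothed_sq {d : ℕ} (hd : 0 < d) {r : ℝ} (hr0 : 1 / 2 < r) (hr1 : r < 1)
    (y h : Fin d → ℝ) {ε : ℝ} (hε : 0 < ε) :
    ConvexOn ℝ Set.univ fun t : ℝ => (∑ j, ((y j + t * h j) ^ 2 + ε) ^ r) ^ (1 / r)
      - (2 * r - 1) * (∑ j, |h j| ^ (2 * r)) ^ (1 / r) * t ^ 2 := by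
  have : Nonempty (Fin d) := ⟨⟨0, hd⟩⟩
  set H := (∑ j, |h j| ^ (2 * r)) ^ (1 / r) with hH
  set z : Fin d → ℝ → ℝ := fun j t => y j + t * h j with hz
  set u : Fin d → ℝ → ℝ := fun j t => z j t ^ 2 + ε with hu
  have hupos : ∀ j t, 0 < u j t := fun j t => by positivity
  set S : ℝ → ℝ := fun t => ∑ j, u j t ^ r with hS
  have hSpos : ∀ t, 0 < S t := fun t =>
    Finset.sum_pos (fun j _ => Real.rpow_pos_of_pos (hupos j t) _) Finset.univ_nonempty
  set S' : ℝ → ℝ := fun t => ∑ j, (2 * z j t * h j) * r * u j t ^ (r - 1) with hS'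
  set S'' : ℝ → ℝ := fun t => ∑ j, ((2 * h j * h j) * r * u j t ^ (r - 1)
    + (2 * z j t * h j) * r * ((2 * z j t * h j) * (r - 1) * u j t ^ (r - 1 - 1))) with hS''
  have dz : ∀ j t, HasDerivAt (z j) (h j) t := fun j t => by
    have := ((hasDerivAt_id t).mul_const (h j)).const_add (y j)
    rwa [one_mul] at this
  have du : ∀ j t, HasDerivAt (u j) (2 * z j t * h j) t := fun j t => by
    have := ((dz j t).pow 2).add_const ε
    simp only [Nat.cast_ofNat, Nat.add_one_sub_one, pow_one] at this
    exact this
  have dS : ∀ t, HasDerivAt S (S' t) t := fun t =>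
    HasDerivAt.fun_sum fun j _ => (du j t).rpow_const (Or.inl (hupos j t).ne')
  have dS' : ∀ t, HasDerivAt S' (S'' t) t := fun t => by
    refine HasDerivAt.fun_sum fun j _ => ?_
    have h1 : HasDerivAt (fun t => 2 * z j t * h j * r) (2 * h j * h j * r) t :=
      (((dz j t).const_mul 2).mul_const (h j)).mul_const r
    exact h1.mul ((du j t).rpow_const (Or.inl (hupos j t).ne'))
  have dF : ∀ t, HasDerivAt (fun t => S t ^ (1 / r) - (2 * r - 1) * H * t ^ 2)
      (S' t * (1 / r) * S t ^ (1 / r - 1) - (2 * r - 1) * H * (2 * t)) t := fun t => by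
    refine ((dS t).rpow_const (Or.inl (hSpos t).ne')).sub ?_
    simpa using (hasDerivAt_pow 2 t).const_mul ((2 * r - 1) * H)
  have dF' : ∀ t, HasDerivAt
      (fun t => S' t * (1 / r) * S t ^ (1 / r - 1) - (2 * r - 1) * H * (2 * t))
      (S'' t * (1 / r) * S t ^ (1 / r - 1)
        + S' t * (1 / r) * (S' t * (1 / r - 1) * S t ^ (1 / r - 1 - 1))
        - (2 * r - 1) * H * 2) t := fun t => by
    refine HasDerivAt.sub ?_ ?_
    · exact ((dS' t).mul_const (1 / r)).mul ((dS t).rpow_const (Or.inl (hSpos t).ne'))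
    · simpa using ((hasDerivAt_id t).const_mul 2).const_mul ((2 * r - 1) * H)
  refine convexOn_of_hasDerivWithinAt2_nonneg convex_univ
    (fun t _ => (dF t).continuousAt.continuousWithinAt) (fun t _ => (dF t).hasDerivWithinAt)
    (fun t _ => (dF' t).hasDerivWithinAt) ?_
  intro t _
  have hrpos : 0 < r := by linarith
  have hr' : 0 ≤ 1 / r - 1 := by
    rw [sub_nonneg, le_div_iff₀ hrpos]; linarith
  -- Each summand of `S''` is `2 r h² u^(r-2) (u - 2 (1 - r) z²)`, and `z² ≤ u` bounds the bracket
  -- below by `(2 r - 1) u`.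
  have hW : 2 * r * (2 * r - 1) * ∑ j, u j t ^ (r - 1) * h j ^ 2 ≤ S'' t := by
    rw [Finset.mul_sum]
    refine Finset.sum_le_sum fun j _ => ?_
    have e : u j t ^ (r - 1) = u j t ^ (r - 1 - 1) * u j t := by
      rw [Real.rpow_sub_one (hupos j t).ne' (r - 1)]
      field_simp [(hupos j t).ne']
    have hp : 0 ≤ u j t ^ (r - 1 - 1) := Real.rpow_nonneg (hupos j t).le _
    have hzu : z j t ^ 2 ≤ u j t := by simp only [hu]; linarith
    rw [e]
    have : 0 ≤ (4 * r * (1 - r) * h j ^ 2 * u j t ^ (r - 1 - 1)) * (u j t - z j t ^ 2) :=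
      mul_nonneg (mul_nonneg (mul_nonneg (by nlinarith) (sq_nonneg _)) hp) (by linarith)
    nlinarith [this]
  have hHle : H ≤ S t ^ (1 / r - 1) * ∑ j, u j t ^ (r - 1) * h j ^ 2 :=
    rpow_sum_abs_le_weighted hrpos hr1 h (fun j => u j t) (fun j => hupos j t)
  have hp1 : 0 ≤ S t ^ (1 / r - 1) := Real.rpow_nonneg (hSpos t).le _
  have hp2 : 0 ≤ S t ^ (1 / r - 1 - 1) := Real.rpow_nonneg (hSpos t).le _
  have h1 : 0 ≤ S' t * (1 / r) * (S' t * (1 / r - 1) * S t ^ (1 / r - 1 - 1)) := by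
    have : 0 ≤ (S' t) ^ 2 * (1 / r) * (1 / r - 1) * S t ^ (1 / r - 1 - 1) := by positivity
    nlinarith [this]
  have h2 : (2 * r - 1) * H * 2 ≤ S'' t * (1 / r) * S t ^ (1 / r - 1) := by
    calc (2 * r - 1) * H * 2
        ≤ (2 * r - 1) * (S t ^ (1 / r - 1) * ∑ j, u j t ^ (r - 1) * h j ^ 2) * 2 := by
          have : 0 ≤ 2 * r - 1 := by linarith
          gcongr
      _ = (2 * r * (2 * r - 1) * ∑ j, u j t ^ (r - 1) * h j ^ 2) * (1 / r)
          * S t ^ (1 / r - 1) := by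
          field_simp
      _ ≤ _ := by gcongr
  linarith

/-- The squared `ℓ^p` norm, `p = 2 r ∈ (1, 2)`, is strongly convex along lines. -/
lemma convexOn_sq_sub {d : ℕ} (hd : 0 < d) {r : ℝ} (hr0 : 1 / 2 < r) (hr1 : r < 1)
    (y h : Fin d → ℝ) :
    ConvexOn ℝ Set.univ fun t : ℝ => (∑ j, |y j + t * h j| ^ (2 * r)) ^ (1 / r)
      - (2 * r - 1) * (∑ j, |h j| ^ (2 * r)) ^ (1 / r) * t ^ 2 := by
  set H := (∑ j, |h j| ^ (2 * r)) ^ (1 / r)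
  set G : ℝ → ℝ → ℝ := fun ε t => (∑ j, ((y j + t * h j) ^ 2 + ε) ^ r) ^ (1 / r)
      - (2 * r - 1) * H * t ^ 2 with hG
  -- Convexity survives pointwise limits, so the smoothing parameter can be sent to `0` from the
  -- right.
  have hlim : ∀ t, Filter.Tendsto (fun ε => G ε t) (nhdsWithin 0 (Set.Ioi 0))
      (nhds ((∑ j, |y j + t * h j| ^ (2 * r)) ^ (1 / r) - (2 * r - 1) * H * t ^ 2)) := by
    intro t
    have hc : Continuous fun ε => G ε t := by
      refine Continuous.sub (Continuous.rpow_const ?_ fun _ => Or.inr (by positivity))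
        continuous_const
      exact continuous_finsetSum _ fun j _ =>
        Continuous.rpow_const (by fun_prop) fun _ => Or.inr (by linarith)
    have h0 : G 0 t = (∑ j, |y j + t * h j| ^ (2 * r)) ^ (1 / r) - (2 * r - 1) * H * t ^ 2 := by
      simp only [hG, add_zero]
      congr 3 with j
      rw [← sq_abs, ← Real.rpow_natCast, ← Real.rpow_mul (abs_nonneg _)]
      norm_num
    rw [← h0]
    exact (hc.tendsto 0).mono_left nhdsWithin_le_nhds
  refine ⟨convex_univ, fun a _ b _ s t hs ht hst => ?_⟩
  refine le_of_tendsto_of_tendsto (hlim _) (((hlim a).const_smul s).add ((hlim b).const_smul t)) ?_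
  filter_upwards [self_mem_nhdsWithin] with ε hε
  exact (convexOn_smoothed_sq hd hr0 hr1 y h hε).2 (Set.mem_univ a) (Set.mem_univ b) hs ht hst

/-! ### The distance generating function -/

lemma one_lt_log {d : ℕ} (hd : 3 ≤ d) : 1 < Real.log d := by
  rw [Real.lt_log_iff_exp_lt (by positivity)]
  have : (3 : ℝ) ≤ d := by exact_mod_cast hd
  linarith [Real.exp_one_lt_three]

lemma one_lt_dgfExponent {d : ℕ} (hd : 3 ≤ d) : 1 < dgfExponent d := by
  have := one_lt_log hd
  unfold dgfExponent
  have : 0 < 1 / Real.log d := by positivity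
  linarith

lemma dgfExponent_lt_two {d : ℕ} (hd : 3 ≤ d) : dgfExponent d < 2 := by
  have h := one_lt_log hd
  unfold dgfExponent
  have : 1 / Real.log d < 1 := by rw [div_lt_one (by linarith)]; exact h
  linarith

/-- The exponent is chosen so that `p - 1 = 1 / log d`: the factors `d ^ (p - 1)` separating the ℓ¹
and ℓ^p norms become absolute constants. -/
lemma natCast_rpow_eq_exp {d : ℕ} (hd : 3 ≤ d) (c : ℝ) :
    (d : ℝ) ^ ((dgfExponent d - 1) * c) = Real.exp c := by
  have h := one_lt_log hd
  rw [Real.rpow_def_of_pos (by positivity)]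
  congr 1
  unfold dgfExponent
  field_simp
  ring

/-- The constant in front of the squared `ℓ^p` norm in `dgf`. -/
noncomputable def dgfConst (d : ℕ) : ℝ :=
  1 / 2 * Real.exp 1 * Real.log d
    * (d : ℝ) ^ ((dgfExponent d - 1) * (2 - dgfExponent d) / dgfExponent d)

lemma dgfConst_eq {d : ℕ} (hd : 3 ≤ d) :
    dgfConst d = 1 / 2 * Real.log d * Real.exp (2 / dgfExponent d) := by
  have := one_lt_dgfExponent hd
  rw [dgfConst, mul_div_assoc, natCast_rpow_eq_exp hd]
  have : Real.exp (2 / dgfExponent d)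
      = Real.exp 1 * Real.exp ((2 - dgfExponent d) / dgfExponent d) := by
    rw [← Real.exp_add]
    congr 1
    field_simp
    ring
  rw [this]
  ring

lemma dgf_eq {d : ℕ} (x : E d) (hd : 3 ≤ d) :
    dgf x = dgfConst d * (∑ j, |x j| ^ dgfExponent d) ^ (2 / dgfExponent d) := by
  have := one_lt_dgfExponent hd
  rw [dgf, dgfConst, lpNorm, ← Real.rpow_natCast, ← Real.rpow_mul]
  · congr 2
    push_cast
    ring
  · exact Finset.sum_nonneg fun j _ => Real.rpow_nonneg (abs_nonneg _) _

lemma dgfConst_pos {d : ℕ} (hd : 3 ≤ d) : 0 < dgfConst d := by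
  have := one_lt_log hd
  rw [dgfConst_eq hd]
  positivity

lemma dgf_nonneg {d : ℕ} (hd : 3 ≤ d) (x : E d) : 0 ≤ dgf x := by
  have := dgfConst_pos hd
  rw [dgf_eq x hd]
  positivity

lemma dgf_zero {d : ℕ} (hd : 3 ≤ d) : dgf (0 : E d) = 0 := by
  have := one_lt_dgfExponent hd
  rw [dgf_eq _ hd]
  have h0 : dgfExponent d ≠ 0 := by linarith
  simp [Real.zero_rpow h0, Real.zero_rpow (div_ne_zero two_ne_zero h0)]

lemma differentiable_dgf {d : ℕ} (hd : 3 ≤ d) : Differentiable ℝ (dgf : E d → ℝ) := by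
  have h1 := one_lt_dgfExponent hd
  have h2 := dgfExponent_lt_two hd
  have : (dgf : E d → ℝ)
      = fun x => dgfConst d * (∑ j, |x j| ^ dgfExponent d) ^ (2 / dgfExponent d) :=
    funext fun x => dgf_eq x hd
  rw [this]
  refine Differentiable.const_mul (Differentiable.rpow_const (Differentiable.fun_sum fun j _ => ?_)
    fun _ => Or.inr ?_) _
  · have hj : Differentiable ℝ fun x : E d => x j := by fun_prop
    exact fun x => DifferentiableAt.comp x (g := fun t : ℝ => |t| ^ dgfExponent d)
      (hasDerivAt_abs_rpow (x j) h1).differentiableAt (hj x)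
  · rw [le_div_iff₀ (by linarith)]
    linarith

lemma l1Norm_nonneg {d : ℕ} (x : E d) : 0 ≤ l1Norm x :=
  Finset.sum_nonneg fun _ _ => abs_nonneg _

lemma rpow_sum_abs_le_l1Norm {d : ℕ} (x : E d) {p : ℝ} (hp : 1 ≤ p) :
    ∑ j, |x j| ^ p ≤ l1Norm x ^ p := by
  have h : ∀ j, |x j| ≤ l1Norm x := fun j =>
    Finset.single_le_sum (f := fun j => |x j|) (fun _ _ => abs_nonneg _) (Finset.mem_univ j)
  have hp1 : 1 + (p - 1) ≠ 0 := by linarith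
  calc ∑ j, |x j| ^ p = ∑ j, |x j| * |x j| ^ (p - 1) := Finset.sum_congr rfl fun j _ => by
        conv_lhs => rw [show p = 1 + (p - 1) by ring]
        rw [Real.rpow_add' (abs_nonneg _) hp1, Real.rpow_one]
    _ ≤ ∑ j, |x j| * l1Norm x ^ (p - 1) := Finset.sum_le_sum fun j _ =>
        mul_le_mul_of_nonneg_left
          (Real.rpow_le_rpow (abs_nonneg _) (h j) (by linarith)) (abs_nonneg _)
    _ = l1Norm x * l1Norm x ^ (p - 1) := by rw [← Finset.sum_mul]; rfl
    _ = l1Norm x ^ p := by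
        conv_rhs => rw [show p = 1 + (p - 1) by ring]
        rw [Real.rpow_add' (l1Norm_nonneg x) hp1, Real.rpow_one]

/-- Combines `‖x‖_p ≤ ‖x‖₁` with `exp (2 / p) ≤ exp 2`. It bounds the initial Bregman divergence of
a stage and so fixes the number of steps. -/
lemma dgf_le {d : ℕ} (hd : 3 ≤ d) (x : E d) : dgf x ≤ dgfGrowth d * l1Norm x ^ 2 := by
  have h1 := one_lt_dgfExponent hd
  have hl := one_lt_log hd
  have hx := l1Norm_nonneg x
  rw [dgf_eq x hd]
  have hc : dgfConst d ≤ dgfGrowth d := by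
    rw [dgfConst_eq hd, dgfGrowth, sq, ← Real.exp_add]
    have : 2 / dgfExponent d ≤ 1 + 1 := by
      rw [div_le_iff₀ (by linarith)]; linarith
    calc _ ≤ 1 / 2 * Real.log d * Real.exp (1 + 1) := by gcongr
      _ = _ := by ring
  have hs : (∑ j, |x j| ^ dgfExponent d) ^ (2 / dgfExponent d) ≤ l1Norm x ^ 2 := by
    calc _ ≤ (l1Norm x ^ dgfExponent d) ^ (2 / dgfExponent d) :=
          Real.rpow_le_rpow (Finset.sum_nonneg fun j _ => Real.rpow_nonneg (abs_nonneg _) _)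
            (rpow_sum_abs_le_l1Norm x h1.le) (by positivity)
      _ = _ := by
          rw [← Real.rpow_mul hx, mul_div_cancel₀ _ (by linarith), Real.rpow_two]
  have := dgfConst_pos hd
  exact mul_le_mul hc hs (by positivity) (this.le.trans hc)

/-- The power mean inequality, in which `d ^ (p - 1) = e`. -/
lemma sq_l1Norm_le {d : ℕ} (hd : 3 ≤ d) (x : E d) :
    l1Norm x ^ 2 ≤ Real.exp (2 / dgfExponent d)
      * (∑ j, |x j| ^ dgfExponent d) ^ (2 / dgfExponent d) := by
  set p := dgfExponent d
  have h1 : 1 < p := one_lt_dgfExponent hd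
  have hS : 0 ≤ ∑ j, |x j| ^ p := Finset.sum_nonneg fun j _ => Real.rpow_nonneg (abs_nonneg _) _
  have h := Real.rpow_sum_le_const_mul_sum_rpow Finset.univ (fun j => x j) h1.le
  have e : (d : ℝ) ^ (p - 1) = Real.exp 1 := by simpa using natCast_rpow_eq_exp hd 1
  simp only [Finset.card_univ, Fintype.card_fin, e] at h
  have hx : 0 ≤ ∑ j, |x j| := l1Norm_nonneg x
  calc l1Norm x ^ 2 = ((∑ j, |x j|) ^ p) ^ (2 / p) := by
        rw [← Real.rpow_mul hx, mul_div_cancel₀ _ (by linarith), Real.rpow_two]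
        rfl
    _ ≤ (Real.exp 1 * ∑ j, |x j| ^ p) ^ (2 / p) :=
        Real.rpow_le_rpow (Real.rpow_nonneg hx _) h (by positivity)
    _ = _ := by
        rw [Real.mul_rpow (Real.exp_pos _).le hS, ← Real.exp_mul, one_mul]

/-- Strong convexity of `dgf` along lines, with respect to the `ℓ¹` norm. -/
lemma convexOn_dgf_line {d : ℕ} (hd : 3 ≤ d) (y h : E d) :
    ConvexOn ℝ Set.univ fun t : ℝ => dgf (y + t • h) - l1Norm h ^ 2 / 2 * t ^ 2 := by
  set p := dgfExponent d with hp
  have h1 : 1 < p := one_lt_dgfExponent hd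
  have h2 : p < 2 := dgfExponent_lt_two hd
  have hl := one_lt_log hd
  have hA := (convexOn_sq_sub (by omega : 0 < d) (r := p / 2) (by linarith) (by linarith)
    (fun j => y j) (fun j => h j)).smul (dgfConst_pos hd).le
  set H := (∑ j, |h j| ^ p) ^ (2 / p) with hH
  -- The factor `p - 1 = 1 / log d` of the convexity modulus cancels the `log d` in `dgfConst`,
  -- leaving exactly the constant that converts the ℓ^p norm to the ℓ¹ norm.
  have hc : 0 ≤ dgfConst d * (p - 1) * H - l1Norm h ^ 2 / 2 := by
    have hs := sq_l1Norm_le hd h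
    have e : dgfConst d * (p - 1) = 1 / 2 * Real.exp (2 / p) := by
      rw [dgfConst_eq hd, ← hp]
      have : p - 1 = 1 / Real.log d := by rw [hp, dgfExponent]; ring
      rw [this]
      field_simp
    rw [e]
    linarith
  have hB : ConvexOn ℝ Set.univ fun t : ℝ => (dgfConst d * (p - 1) * H - l1Norm h ^ 2 / 2)
      • t ^ 2 := (even_two.convexOn_pow (𝕜 := ℝ)).smul hc
  refine (hA.add hB).congr fun t _ => ?_
  rw [dgf_eq _ hd, ← hp]
  simp only [Pi.add_apply, smul_eq_mul, PiLp.add_apply, PiLp.smul_apply, one_div_div,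
    mul_div_cancel₀ p (two_ne_zero' ℝ)]
  ring

lemma hasGradientAt_dgf_sub {d : ℕ} (hd : 3 ≤ d) (c x : E d) :
    HasGradientAt (fun φ => dgf (φ - c)) (gradient (fun φ => dgf (φ - c)) x) x :=
  DifferentiableAt.hasGradientAt
    ((differentiable_dgf hd).comp (differentiable_id.sub_const c) x)

/-- The derivative along a line of a function with a gradient. -/
lemma hasDerivAt_line {d : ℕ} {f : E d → ℝ} {g y h : E d} {t : ℝ}
    (hf : HasGradientAt f g (y + t • h)) :
    HasDerivAt (fun t : ℝ => f (y + t • h)) (inner ℝ g h) t := by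
  have hl : HasDerivAt (fun t : ℝ => y + t • h) h t := by
    simpa using ((hasDerivAt_id t).smul_const h).const_add y
  exact hf.hasFDerivAt.comp_hasDerivAt t hl

/-- A convex function on the line lies above its tangents. -/
lemma tangent_le_of_convexOn {f : ℝ → ℝ} {f' : ℝ} (hf : ConvexOn ℝ Set.univ f)
    (hd : HasDerivAt f f' 0) : f 0 + f' ≤ f 1 := by
  have := hf.le_slope_of_hasDerivAt (Set.mem_univ (0 : ℝ)) (Set.mem_univ (1 : ℝ)) one_pos hd
  rw [slope_def_field] at this
  norm_num at this
  linarith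

/-- The tangent inequality at `t = 0`, read at `t = 1`, for the convex function of
`convexOn_dgf_line` on the segment from `y` to `x`. -/
lemma sq_l1Norm_le_bregman {d : ℕ} (hd : 3 ≤ d) (c x y : E d) :
    l1Norm (x - y) ^ 2 / 2 ≤ bregman c x y := by
  have hconv := convexOn_dgf_line hd (y - c) (x - y)
  have hder : HasDerivAt (fun t : ℝ => dgf (y - c + t • (x - y)) - l1Norm (x - y) ^ 2 / 2 * t ^ 2)
      (inner ℝ (gradient (fun φ => dgf (φ - c)) y) (x - y) - 0) 0 := by
    refine HasDerivAt.sub ?_ ?_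
    · have h0 : HasGradientAt (fun φ => dgf (φ - c)) (gradient (fun φ => dgf (φ - c)) y)
          (y + (0 : ℝ) • (x - y)) := by
        simpa using hasGradientAt_dgf_sub hd c y
      refine (hasDerivAt_line h0).congr_of_eventuallyEq (Filter.Eventually.of_forall fun t => ?_)
      simp only [add_sub_right_comm]
    · simpa using (hasDerivAt_pow 2 (0 : ℝ)).const_mul (l1Norm (x - y) ^ 2 / 2)
  have := tangent_le_of_convexOn hconv hder
  have e1 : y - c + (1 : ℝ) • (x - y) = x - c := by rw [one_smul]; abel
  have e0 : y - c + (0 : ℝ) • (x - y) = y - c := by simp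
  rw [e1, e0] at this
  unfold bregman
  linarith

/-- The centre minimizes the shifted `dgf`, so both value and gradient vanish there. -/
lemma bregman_center {d : ℕ} (hd : 3 ≤ d) (c x : E d) : bregman c x c = dgf (x - c) := by
  have : gradient (fun φ => dgf (φ - c)) c = 0 := by
    have h : IsLocalMin (fun φ : E d => dgf (φ - c)) c := Filter.Eventually.of_forall fun x => by
      simp only [sub_self, dgf_zero hd]
      exact dgf_nonneg hd _
    simp [gradient, h.fderiv_eq_zero]
  simp [bregman, this, dgf_zero hd]

/-! ### Norm inequalities -/

lemma abs_le_linftyNorm {d : ℕ} (x : E d) (j : Fin d) : |x j| ≤ linftyNorm x :=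
  le_ciSup (f := fun j => |x j|) (Set.finite_range _).bddAbove j

lemma inner_le_of_abs_le {d : ℕ} {x : E d} {c : ℝ} (hx : ∀ j, |x j| ≤ c) (y : E d) :
    inner ℝ x y ≤ c * l1Norm y := by
  rw [PiLp.inner_apply, l1Norm, Finset.mul_sum]
  refine Finset.sum_le_sum fun j _ => ?_
  calc inner ℝ (x j) (y j) ≤ |x j * y j| := by
        rw [mul_comm]
        exact le_abs_self _
    _ ≤ c * |y j| := by
        rw [abs_mul]
        exact mul_le_mul_of_nonneg_right (hx j) (abs_nonneg _)

lemma l1Norm_smul {d : ℕ} (t : ℝ) (x : E d) : l1Norm (t • x) = |t| * l1Norm x := by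
  simp [l1Norm, abs_mul, Finset.mul_sum]

lemma l1Norm_sub_comm {d : ℕ} (x y : E d) : l1Norm (x - y) = l1Norm (y - x) := by
  simp [l1Norm, abs_sub_comm]

lemma l1Norm_add_le {d : ℕ} (x y : E d) : l1Norm (x + y) ≤ l1Norm x + l1Norm y := by
  simp only [l1Norm, ← Finset.sum_add_distrib]
  exact Finset.sum_le_sum fun j _ => abs_add_le _ _

lemma l1Norm_zero {d : ℕ} : l1Norm (0 : E d) = 0 := by simp [l1Norm]

lemma l1Norm_sub_le {d : ℕ} (x y z : E d) : l1Norm (x - z) ≤ l1Norm (x - y) + l1Norm (y - z) := by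
  simpa using l1Norm_add_le (x - y) (y - z)

lemma convexOn_l1Norm_sub {d : ℕ} (c : E d) : ConvexOn ℝ Set.univ fun x => l1Norm (x - c) := by
  refine ⟨convex_univ, fun x _ y _ a b ha hb hab => ?_⟩
  have : a • x + b • y - c = a • (x - c) + b • (y - c) := by
    rw [smul_sub, smul_sub]
    nth_rewrite 1 [← one_smul ℝ c]
    rw [← hab, add_smul]
    abel
  simp only [this]
  refine (l1Norm_add_le _ _).trans_eq ?_
  rw [l1Norm_smul, l1Norm_smul, abs_of_nonneg ha, abs_of_nonneg hb]
  rfl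

lemma convex_l1Ball {d : ℕ} (c : E d) (r : ℝ) : Convex ℝ (l1Ball c r) := by
  have := (convexOn_l1Norm_sub c).convex_le r
  simpa [l1Ball] using this

lemma sq_l1Norm_le_sparsity_mul {d : ℕ} (x : E d) :
    l1Norm x ^ 2 ≤ sparsity x * ‖x‖ ^ 2 := by
  have h1 : l1Norm x = ∑ j ∈ Finset.univ.filter fun j => x j ≠ 0, |x j| := by
    rw [l1Norm, Finset.sum_filter_of_ne]
    intro j _ h
    simpa using h
  have h2 : ∑ j ∈ Finset.univ.filter (fun j => x j ≠ 0), |x j| ^ 2 ≤ ‖x‖ ^ 2 := by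
    rw [EuclideanSpace.norm_sq_eq]
    exact Finset.sum_le_sum_of_subset_of_nonneg (Finset.filter_subset _ _)
      fun j _ _ => by positivity
  rw [h1]
  refine sq_sum_le_card_mul_sum_sq.trans ?_
  exact mul_le_mul_of_nonneg_left h2 (Nat.cast_nonneg _)

lemma sparsity_sub_le {d : ℕ} (x y : E d) : sparsity (x - y) ≤ sparsity x + sparsity y := by
  refine (Finset.card_le_card ?_).trans (Finset.card_union_le _ _)
  intro j hj
  have hj' := (Finset.mem_filter.1 hj).2
  simp only [Finset.mem_filter, Finset.mem_univ, true_and, Finset.mem_union]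
  by_contra! h
  rw [PiLp.sub_apply, h.1, h.2, sub_zero] at hj'
  exact hj' rfl

/-! ### Descent and proximal inequalities -/

lemma line_mem {d : ℕ} {D : Set (E d)} (hD : Convex ℝ D) {x y : E d} (hx : x ∈ D) (hy : y ∈ D)
    {t : ℝ} (ht0 : 0 ≤ t) (ht1 : t ≤ 1) : x + t • (y - x) ∈ D :=
  hD.add_smul_sub_mem hx hy ⟨ht0, ht1⟩

/-- The descent lemma for a function whose gradient is Lipschitz from `ℓ¹` to `ℓ^∞`. -/
lemma le_quadratic_of_lipschitz_gradient {d : ℕ} {Θ : Set (E d)} (hΘ : Convex ℝ Θ) {f : E d → ℝ}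
    {g : E d → E d} (hg : ∀ x, HasGradientAt f (g x) x) {L : ℝ}
    (hL : ∀ x ∈ Θ, ∀ y ∈ Θ, linftyNorm (g x - g y) ≤ L * l1Norm (x - y))
    {x y : E d} (hx : x ∈ Θ) (hy : y ∈ Θ) :
    f y ≤ f x + inner ℝ (g x) (y - x) + L / 2 * l1Norm (y - x) ^ 2 := by
  set h := y - x with hh
  have hder : ∀ t : ℝ, HasDerivAt (fun t : ℝ => f (x + t • h) - t * inner ℝ (g x) h
      - L / 2 * l1Norm h ^ 2 * t ^ 2)
      (inner ℝ (g (x + t • h)) h - inner ℝ (g x) h - L / 2 * l1Norm h ^ 2 * (2 * t)) t := by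
    intro t
    refine ((hasDerivAt_line (hg _)).sub ?_).sub ?_
    · simpa using (hasDerivAt_id t).mul_const (inner ℝ (g x) h)
    · simpa using (hasDerivAt_pow 2 t).const_mul (L / 2 * l1Norm h ^ 2)
  -- Along the segment the gradient moves by at most `L t ‖h‖₁` in ℓ^∞, so subtracting the quadratic
  -- model leaves a nonpositive derivative.
  have hanti : AntitoneOn (fun t : ℝ => f (x + t • h) - t * inner ℝ (g x) h
      - L / 2 * l1Norm h ^ 2 * t ^ 2) (Set.Icc 0 1) := by
    refine antitoneOn_of_deriv_nonpos (convex_Icc 0 1)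
      (fun t _ => (hder t).continuousAt.continuousWithinAt)
      (fun t _ => (hder t).differentiableAt.differentiableWithinAt) fun t ht => ?_
    rw [interior_Icc] at ht
    rw [(hder t).deriv, ← inner_sub_left]
    have hm := line_mem hΘ hx hy ht.1.le ht.2.le
    have h1 := inner_le_of_abs_le
      (fun j => (abs_le_linftyNorm (g (x + t • h) - g x) j).trans (hL _ hm _ hx)) h
    rw [add_sub_cancel_left, l1Norm_smul, abs_of_pos ht.1] at h1
    linarith
  have := hanti (Set.left_mem_Icc.2 zero_le_one) (Set.right_mem_Icc.2 zero_le_one) zero_le_one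
  have e : x + (1 : ℝ) • h = y := by rw [one_smul, hh]; abel
  simp only [e, zero_smul, add_zero] at this
  linarith

lemma deriv_nonneg_of_min_right {f : ℝ → ℝ} {f' : ℝ} (hf : HasDerivAt f f' 0)
    (hmin : ∀ t, 0 < t → t ≤ 1 → f 0 ≤ f t) : 0 ≤ f' := by
  have := (hasDerivAt_iff_tendsto_slope.1 hf).mono_left
    (nhdsWithin_mono 0 fun t (ht : t ∈ Set.Ioi (0 : ℝ)) => (ne_of_gt ht : t ≠ 0))
  refine ge_of_tendsto this ?_
  filter_upwards [Ioc_mem_nhdsGT (zero_lt_one' ℝ)] with t ht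
  rw [slope_def_field]
  exact div_nonneg (sub_nonneg.2 (hmin t ht.1 ht.2)) (by linarith [ht.1])

/-- The three-point inequality for the corrected proximal operator. -/
lemma IsCorrectedProx.three_point {d : ℕ} (hd : 3 ≤ d) {β ε : ℝ} (hβε : 0 ≤ β * ε)
    {u θ θ₀ θ' : E d} {D : Set (E d)} (hD : Convex ℝ D) (h : IsCorrectedProx β ε u θ θ₀ D θ')
    {v : E d} (hv : v ∈ D) :
    inner ℝ (β • u) θ' + β * ε * l1Norm (θ' - θ) + bregman θ₀ θ' θ + bregman θ₀ v θ'
      ≤ inner ℝ (β • u) v + β * ε * l1Norm (v - θ) + bregman θ₀ v θ := by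
  set Ω : E d → ℝ := fun φ => dgf (φ - θ₀) with hΩ
  set G := gradient Ω θ with hG
  set G' := gradient Ω θ' with hG'
  obtain ⟨hmem, hmin⟩ := h
  -- The ℓ¹ penalty is not differentiable. By convexity it lies below its chord from `θ'` to `v`;
  -- replacing it by the chord gives a differentiable function of `t`, still minimal at `t = 0` from
  -- the right.
  have hder : HasDerivAt (fun t : ℝ => t * (inner ℝ (β • u) (v - θ')
      + β * ε * (l1Norm (v - θ) - l1Norm (θ' - θ)) - inner ℝ G (v - θ')) + Ω (θ' + t • (v - θ')))
      (1 * (inner ℝ (β • u) (v - θ') + β * ε * (l1Norm (v - θ) - l1Norm (θ' - θ))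
        - inner ℝ G (v - θ')) + inner ℝ G' (v - θ')) 0 := by
    refine ((hasDerivAt_id 0).mul_const _).add (hasDerivAt_line ?_)
    simpa using hasGradientAt_dgf_sub hd θ₀ θ'
  have hnn := deriv_nonneg_of_min_right hder fun t ht0 ht1 => by
    have hm := hmin (line_mem hD hmem hv ht0.le ht1)
    have hc := (convexOn_l1Norm_sub θ).2 (Set.mem_univ θ') (Set.mem_univ v)
      (sub_nonneg.2 ht1) ht0.le (by ring)
    have e : (1 - t) • θ' + t • v = θ' + t • (v - θ') := by
      rw [sub_smul, smul_sub, one_smul]; abel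
    simp only [e, smul_eq_mul] at hc
    have hc' := mul_le_mul_of_nonneg_left hc hβε
    simp only [Set.mem_ofPred_eq, bregman, inner_add_right, inner_sub_right,
      inner_smul_right] at hm
    simp only [zero_smul, add_zero, zero_mul, zero_add, inner_sub_right]
    simp only [hΩ, hG]
    linarith
  simp only [bregman, inner_sub_right] at *
  linarith

lemma bregman_nonneg {d : ℕ} (hd : 3 ≤ d) (c x y : E d) : 0 ≤ bregman c x y :=
  le_trans (by positivity) (sq_l1Norm_le_bregman hd c x y)

lemma bregman_self {d : ℕ} (c x : E d) : bregman c x x = 0 := by simp [bregman]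

/-- Progress made in one step of the corrected proximal method, when the error of the gradient
estimate is at most `ε`. -/
lemma IsCorrectedProx.progress {d : ℕ} (hd : 3 ≤ d) {Θ : Set (E d)} (hΘ : Convex ℝ Θ)
    {f : E d → ℝ} {g : E d → E d} (hg : ∀ x, HasGradientAt f (g x) x)
    (hconv : ∀ x y, f x + inner ℝ (g x) (y - x) ≤ f y) {L : ℝ} (hL0 : 0 < L)
    (hL : ∀ x ∈ Θ, ∀ y ∈ Θ, linftyNorm (g x - g y) ≤ L * l1Norm (x - y))
    {β ε : ℝ} (hβ : 0 < β) (hβL : β ≤ 1 / L) (hε : 0 ≤ ε)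
    {u θ θ₀ θ' : E d} {D : Set (E d)} (hD : Convex ℝ D) (hDΘ : D ⊆ Θ) (hθ : θ ∈ D)
    (h : IsCorrectedProx β ε u θ θ₀ D θ') (hu : ∀ j, |u j - g θ j| ≤ ε) {v : E d} (hv : v ∈ D) :
    β * (f θ' - f v) ≤ 2 * β * ε * l1Norm (v - θ) + bregman θ₀ v θ - bregman θ₀ v θ' := by
  have h3 := h.three_point hd (by positivity) hD hv
  have hdesc := le_quadratic_of_lipschitz_gradient hΘ hg hL (hDΘ hθ) (hDΘ h.1)
  have hbreg := sq_l1Norm_le_bregman hd θ₀ θ' θ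
  -- The error along `θ' - θ` cancels against the penalty paid at `θ'`; the error along `v - θ` adds
  -- to the penalty at `v`, whence the factor `2`.
  have e1 : inner ℝ (g θ - u) (θ' - θ) ≤ ε * l1Norm (θ' - θ) :=
    inner_le_of_abs_le (fun j => by rw [PiLp.sub_apply, abs_sub_comm]; exact hu j) _
  have e2 : inner ℝ (u - g θ) (v - θ) ≤ ε * l1Norm (v - θ) :=
    inner_le_of_abs_le (fun j => by rw [PiLp.sub_apply]; exact hu j) _
  have hc := hconv θ v
  -- As `β L ≤ 1`, strong convexity of the divergence pays for the quadratic term of the descent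
  -- lemma.
  have hLβ : β * (L / 2 * l1Norm (θ' - θ) ^ 2) ≤ bregman θ₀ θ' θ := by
    have : β * L ≤ 1 := by rwa [le_div_iff₀ hL0] at hβL
    nlinarith [sq_nonneg (l1Norm (θ' - θ))]
  simp only [inner_sub_left, inner_sub_right, real_inner_smul_left] at *
  have m1 := mul_le_mul_of_nonneg_left hdesc hβ.le
  have m2 := mul_le_mul_of_nonneg_left e1 hβ.le
  have m3 := mul_le_mul_of_nonneg_left e2 hβ.le
  have m4 := mul_le_mul_of_nonneg_left hc hβ.le
  linarith

/-- The excess of the objective after one stage. -/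
lemma stage_excess_le {d : ℕ} (hd : 3 ≤ d) {Θ : Set (E d)} (hΘ : Convex ℝ Θ)
    {f : E d → ℝ} {g : E d → E d} (hg : ∀ x, HasGradientAt f (g x) x)
    (hconv : ∀ x y, f x + inner ℝ (g x) (y - x) ≤ f y) {L : ℝ} (hL0 : 0 < L)
    (hL : ∀ x ∈ Θ, ∀ y ∈ Θ, linftyNorm (g x - g y) ≤ L * l1Norm (x - y))
    {β ε r : ℝ} (hβ : 0 < β) (hβL : β ≤ 1 / L) (hε : 0 < ε) (hr : 0 < r)
    {c v : E d} (hc : c ∈ Θ) (hv : v ∈ Θ) (hvc : l1Norm (v - c) ≤ r)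
    {x : ℕ → E d} {u : ℕ → E d} (hx0 : x 0 = c) {N : ℕ} (hN : N = ⌈dgfGrowth d * r / (β * ε)⌉₊)
    (hstep : ∀ t < N, IsCorrectedProx β ε (u t) (x t) c (Θ ∩ l1Ball c r) (x (t + 1)))
    (hu : ∀ t < N, ∀ j, |u t j - g (x t) j| ≤ ε) :
    f (x N) - f v ≤ 5 * ε * r := by
  set D := Θ ∩ l1Ball c r with hDdef
  have hD : Convex ℝ D := hΘ.inter (convex_l1Ball c r)
  have hcD : c ∈ D := ⟨hc, by simp [l1Ball, l1Norm_zero, hr.le]⟩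
  have hvD : v ∈ D := ⟨hv, hvc⟩
  have hmem : ∀ t ≤ N, x t ∈ D := by
    intro t ht
    rcases t with _ | t
    · rwa [hx0]
    · exact (hstep t ht).1
  have hprog : ∀ t, t < N → ∀ w ∈ D,
      β * (f (x (t + 1)) - f w)
        ≤ 2 * β * ε * l1Norm (w - x t) + bregman c w (x t) - bregman c w (x (t + 1)) :=
    fun t ht w hw => (hstep t ht).progress hd hΘ hg hconv hL0 hL hβ hβL hε.le hD
      Set.inter_subset_left (hmem t ht.le) (hu t ht) hw
  -- The left side carries `n` copies of the excess at the last iterate; monotonicity of the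
  -- objective replaces the usual sum over all iterates.
  have hind : ∀ n ≤ N, β * n * (f (x n) - f v)
      ≤ 4 * β * ε * r * n + bregman c v c - bregman c v (x n) := by
    intro n
    induction n with
    | zero => intro _; simp [hx0]
    | succ n ih =>
      intro hn
      have h1 := ih (by omega)
      have h2 := hprog n hn v hvD
      -- The comparison point is the current iterate, for which the error term vanishes: the step is
      -- a descent step.
      have h3 := hprog n hn (x n) (hmem n (by omega))
      rw [sub_self, l1Norm_zero, bregman_self] at h3
      have h4 : f (x (n + 1)) ≤ f (x n) := by
        have := bregman_nonneg hd c (x n) (x (n + 1))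
        have h5 : β * (f (x (n + 1)) - f (x n)) ≤ 0 := by linarith
        nlinarith
      have h6 : l1Norm (v - x n) ≤ 2 * r := by
        have h7 := l1Norm_sub_le v c (x n)
        have h8 : l1Norm (x n - c) ≤ r := (hmem n (by omega)).2
        rw [l1Norm_sub_comm c] at h7
        linarith
      have h9 : β * n * (f (x (n + 1)) - f v) ≤ β * n * (f (x n) - f v) := by gcongr
      have h10 : 2 * β * ε * l1Norm (v - x n) ≤ 2 * β * ε * (2 * r) := by gcongr
      push_cast
      linarith
  have hl := one_lt_log hd
  have hν : 0 < dgfGrowth d := by unfold dgfGrowth; positivity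
  have hNle : dgfGrowth d * r / (β * ε) ≤ N := by rw [hN]; exact Nat.le_ceil _
  rw [div_le_iff₀ (by positivity)] at hNle
  have hNpos : (0 : ℝ) < N := by
    rw [hN]; exact_mod_cast Nat.ceil_pos.2 (by positivity)
  have hfin := hind N le_rfl
  have hV : bregman c v c ≤ dgfGrowth d * r ^ 2 := by
    rw [bregman_center hd]
    refine (dgf_le hd _).trans ?_
    have := l1Norm_nonneg (v - c)
    gcongr
  -- The stage length makes the initial divergence cost at most `ε r` per step; with the `4 ε r` of
  -- the gradient errors this gives `5 ε r`.
  have hV' : dgfGrowth d * r ^ 2 ≤ N * (β * ε) * r := by nlinarith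
  have := bregman_nonneg hd c v (x N)
  have h11 : (β * N) * (f (x N) - f v) ≤ (β * N) * (5 * ε * r) := by linarith
  exact le_of_mul_le_mul_left h11 (by positivity)

/-! ### Multistage analysis -/

lemma stageRadius_pos {sbar : ℕ} {R κ ε : ℝ} (hR : 0 < R) (hκ : 0 < κ) (hε : 0 ≤ ε) (k : ℕ) :
    0 < stageRadius sbar R κ ε k := by
  induction k with
  | zero => exact hR
  | succ k ih => rw [stageRadius]; positivity

/-- The recursion halves the distance to its fixed point `40 sbar ε / κ`. -/
lemma stageRadius_le {sbar : ℕ} {R κ ε : ℝ} (hκ : 0 < κ) (hε : 0 ≤ ε) (k : ℕ) :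
    stageRadius sbar R κ ε k ≤ (2 : ℝ)⁻¹ ^ k * R + 40 * sbar * ε / κ := by
  induction k with
  | zero => simp [stageRadius]; positivity
  | succ k ih => rw [stageRadius, pow_succ]; linarith

lemma IsAMMDRun.out_mem {d : ℕ} {Θ : Set (E d)} {θ₀ : E d} {sbar : ℕ} {R κ β ε : ℝ} {K : ℕ}
    {g : ℕ → E d → E d} {θ : ℕ → ℕ → E d} {out : ℕ → E d}
    (h : IsAMMDRun Θ θ₀ sbar R κ β ε K g θ out) (hθ₀ : θ₀ ∈ Θ) {k : ℕ} (hk : k ≤ K) :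
    out k ∈ Θ := by
  rcases k with _ | k
  · rwa [h.init]
  · exact (h.sparsify k hk).1

lemma IsAMMDRun.iterate_mem {d : ℕ} {Θ : Set (E d)} {θ₀ : E d} {sbar : ℕ} {R κ β ε : ℝ} {K : ℕ}
    {g : ℕ → E d → E d} {θ : ℕ → ℕ → E d} {out : ℕ → E d}
    (h : IsAMMDRun Θ θ₀ sbar R κ β ε K g θ out) (hθ₀ : θ₀ ∈ Θ) {k t : ℕ} (hk : k < K)
    (ht : t ≤ stageLength d sbar R κ β ε k) : θ k t ∈ Θ := by
  rcases t with _ | t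
  · rw [h.start k hk]; exact h.out_mem hθ₀ hk.le
  · exact (h.step k hk t ht).1.1

/-- Accuracy of the output of a run of AMMD all of whose gradient estimates have error at most
`ε` in the `ℓ^∞` norm. -/
lemma IsAMMDRun.norm_sub_le {d : ℕ} (hd : 3 ≤ d) {Θ : Set (E d)} (hΘ : Convex ℝ Θ)
    {f : E d → ℝ} {g : E d → E d} (hg : ∀ x, HasGradientAt f (g x) x)
    (hconv : ∀ x y, f x + inner ℝ (g x) (y - x) ≤ f y) {L : ℝ} (hL0 : 0 < L)
    (hL : ∀ x ∈ Θ, ∀ y ∈ Θ, linftyNorm (g x - g y) ≤ L * l1Norm (x - y))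
    {β ε R κ : ℝ} (hβ : 0 < β) (hβL : β ≤ 1 / L) (hε : 0 < ε) (hR : 0 < R) (hκ : 0 < κ)
    {θ₀ θstar : E d} (hθ₀ : θ₀ ∈ Θ) (hstar : θstar ∈ Θ) {sbar : ℕ} (hsbar : 1 ≤ sbar)
    (hsparse : sparsity θstar ≤ sbar)
    (hgrowth : ∀ x ∈ Θ, κ * ‖x - θstar‖ ^ 2 ≤ f x - f θstar)
    (hball : θstar ∈ l1Ball θ₀ R) {K : ℕ} (hK : 1 ≤ K)
    {ghat : ℕ → E d → E d} {θ : ℕ → ℕ → E d} {out : ℕ → E d}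
    (h : IsAMMDRun Θ θ₀ sbar R κ β ε K ghat θ out)
    (hgood : ∀ k < K, ∀ t < stageLength d sbar R κ β ε k, ∀ j,
      |ghat (stageStart d sbar R κ β ε k + t) (θ k t) j - g (θ k t) j| ≤ ε) :
    ‖out K - θstar‖ ≤ stageRadius sbar R κ ε K / Real.sqrt (2 * sbar) := by
  have hs0 : (0 : ℝ) < sbar := by exact_mod_cast hsbar
  have hsq : 0 < Real.sqrt (2 * sbar) := Real.sqrt_pos.2 (by positivity)
  have hsq2 : Real.sqrt (2 * sbar) ^ 2 = 2 * sbar := Real.sq_sqrt (by positivity)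
  have step : ∀ k < K, l1Norm (θstar - out k) ≤ stageRadius sbar R κ ε k →
      ‖out (k + 1) - θstar‖ ≤ stageRadius sbar R κ ε (k + 1) / Real.sqrt (2 * sbar) := by
    intro k hk hin
    set r := stageRadius sbar R κ ε k with hr
    have hrpos : 0 < r := stageRadius_pos hR hκ hε.le k
    have hex := stage_excess_le hd hΘ hg hconv hL0 hL hβ hβL hε hrpos
      (h.out_mem hθ₀ hk.le) hstar hin (h.start k hk) rfl (h.step k hk) (hgood k hk)
    set xN := θ k (stageLength d sbar R κ β ε k) with hxN
    have hgr := hgrowth xN (h.iterate_mem hθ₀ hk le_rfl)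
    have h1 : κ * ‖xN - θstar‖ ^ 2 ≤ 5 * ε * r := hgr.trans hex
    -- `θstar` is itself a competitor for the sparsification.
    have h2 : ‖out (k + 1) - xN‖ ≤ ‖θstar - xN‖ :=
      (h.sparsify k hk).2.2 θstar hstar hsparse
    have h3 : ‖out (k + 1) - θstar‖ ≤ 2 * ‖xN - θstar‖ := by
      have := norm_sub_le_norm_sub_add_norm_sub (out (k + 1)) xN θstar
      rw [norm_sub_rev θstar] at h2
      linarith
    rw [le_div_iff₀ hsq]
    refine abs_le_of_sq_le_sq' ?_ (stageRadius_pos hR hκ hε.le _).le |>.2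
    rw [mul_pow, hsq2, stageRadius, ← hr]
    have h4 : ‖out (k + 1) - θstar‖ ^ 2 ≤ 4 * ‖xN - θstar‖ ^ 2 := by
      calc _ ≤ (2 * ‖xN - θstar‖) ^ 2 := by gcongr
        _ = _ := by ring
    have h5 : ‖xN - θstar‖ ^ 2 ≤ 5 * ε * r / κ := by
      rw [le_div_iff₀ hκ]; linarith
    -- The last step is `r c ≤ ((r + c) / 2) ^ 2` with `c = 40 sbar ε / κ`; the update of the radius
    -- is designed for it.
    calc ‖out (k + 1) - θstar‖ ^ 2 * (2 * sbar) ≤ (4 * (5 * ε * r / κ)) * (2 * sbar) := by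
          gcongr; linarith
      _ = r * (40 * sbar * ε / κ) := by ring
      _ ≤ _ := by nlinarith [sq_nonneg (r - 40 * sbar * ε / κ)]
  have inv : ∀ k ≤ K, l1Norm (θstar - out k) ≤ stageRadius sbar R κ ε k := by
    intro k
    induction k with
    | zero => intro _; rw [h.init]; exact hball
    | succ k ih =>
      intro hk
      have h1 := step k hk (ih (by omega))
      have h2 := sq_l1Norm_le_sparsity_mul (θstar - out (k + 1))
      have h3 : (sparsity (θstar - out (k + 1)) : ℝ) ≤ 2 * sbar := by
        have := sparsity_sub_le θstar (out (k + 1))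
        have := (h.sparsify k hk).2.1
        exact_mod_cast (by omega : sparsity (θstar - out (k + 1)) ≤ 2 * sbar)
      have hpos := (stageRadius_pos (sbar := sbar) hR hκ hε.le (k + 1)).le
      refine abs_le_of_sq_le_sq' ?_ hpos |>.2
      rw [le_div_iff₀ hsq, norm_sub_rev] at h1
      calc _ ≤ (sparsity (θstar - out (k + 1)) : ℝ) * ‖θstar - out (k + 1)‖ ^ 2 := h2
        _ ≤ (2 * sbar) * ‖θstar - out (k + 1)‖ ^ 2 := by gcongr
        _ = (‖θstar - out (k + 1)‖ * Real.sqrt (2 * sbar)) ^ 2 := by rw [mul_pow, hsq2]; ring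
        _ ≤ _ := by gcongr
  obtain ⟨k, rfl⟩ : ∃ k, K = k + 1 := ⟨K - 1, by omega⟩
  exact step k (by omega) (inv k (by omega))

lemma stageRadius_div_sqrt_le {sbar K : ℕ} (hsbar : 1 ≤ sbar) {R κ ε : ℝ} (hR : 0 < R)
    (hκ : 0 < κ) (hε : 0 ≤ ε) :
    stageRadius sbar R κ ε K / Real.sqrt (2 * sbar)
      ≤ (2 : ℝ) ^ (-(K : ℝ) / 2) * R / Real.sqrt sbar + 20 * Real.sqrt (2 * sbar) * ε / κ := by
  have hs0 : (0 : ℝ) < sbar := by exact_mod_cast hsbar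
  have hsq : 0 < Real.sqrt (2 * sbar) := Real.sqrt_pos.2 (by positivity)
  have hsq2 : Real.sqrt (2 * sbar) ^ 2 = 2 * sbar := Real.sq_sqrt (by positivity)
  have h1 := stageRadius_le (sbar := sbar) (R := R) hκ hε K
  have h2 : (2 : ℝ)⁻¹ ^ K ≤ (2 : ℝ) ^ (-(K : ℝ) / 2) := by
    rw [inv_pow, ← Real.rpow_natCast, ← Real.rpow_neg zero_le_two]
    refine Real.rpow_le_rpow_of_exponent_le one_le_two ?_
    have : (0 : ℝ) ≤ K := Nat.cast_nonneg K
    linarith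
  -- The stated first term is weaker than what is available, both in the power of `2` and in the
  -- factor `√2` of the denominator.
  have h3 : (2 : ℝ)⁻¹ ^ K * R / Real.sqrt (2 * sbar)
      ≤ (2 : ℝ) ^ (-(K : ℝ) / 2) * R / Real.sqrt sbar := by
    have : 0 < Real.sqrt sbar := Real.sqrt_pos.2 hs0
    have : Real.sqrt sbar ≤ Real.sqrt (2 * sbar) := Real.sqrt_le_sqrt (by linarith)
    gcongr
  have h4 : 40 * sbar * ε / κ / Real.sqrt (2 * sbar) = 20 * Real.sqrt (2 * sbar) * ε / κ := by
    rw [div_eq_iff hsq.ne']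
    calc 40 * sbar * ε / κ = 20 * Real.sqrt (2 * sbar) ^ 2 * ε / κ := by rw [hsq2]; ring
      _ = _ := by ring
  calc _ ≤ ((2 : ℝ)⁻¹ ^ K * R + 40 * sbar * ε / κ) / Real.sqrt (2 * sbar) := by gcongr
    _ ≤ _ := by rw [add_div, h4]; gcongr

/-! ### The derivative of the loss -/

open Classical in
/-- The derivative of the loss in the first argument, set to zero for improper labels. -/
noncomputable def lossDeriv (labels : Set ℝ) (loss : ℝ → ℝ → ℝ) (q : ℝ × ℝ) : ℝ :=
  if q.2 ∈ labels then deriv (fun t => loss t q.2) q.1 else 0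

lemma lossDeriv_of_mem {labels : Set ℝ} {loss : ℝ → ℝ → ℝ} {q : ℝ × ℝ} (h : q.2 ∈ labels) :
    lossDeriv labels loss q = deriv (fun t => loss t q.2) q.1 := if_pos h

-- A pointwise limit of difference quotients with increments `1 / (n + 1)`. Differentiability is
-- known for proper labels only, hence the cut-off.
open Classical in
lemma measurable_lossDeriv {labels : Set ℝ} (h_labels : MeasurableSet labels)
    {loss : ℝ → ℝ → ℝ} (h_loss : IsAdmissibleLoss labels loss) :
    Measurable (lossDeriv labels loss) := by
  set F : ℕ → ℝ × ℝ → ℝ := fun n q => if q.2 ∈ labels then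
    ((n : ℝ) + 1) * (loss (q.1 + 1 / ((n : ℝ) + 1)) q.2 - loss q.1 q.2) else 0 with hF
  refine measurable_of_tendsto_metrizable (f := F) (fun n => ?_) ?_
  · refine Measurable.ite (measurable_snd h_labels) ?_ measurable_const
    have h1 : Measurable fun q : ℝ × ℝ => loss (q.1 + 1 / ((n : ℝ) + 1)) q.2 :=
      h_loss.measurable.comp ((measurable_fst.add_const _).prodMk measurable_snd)
    have h2 : Measurable fun q : ℝ × ℝ => loss q.1 q.2 := h_loss.measurable
    exact (h1.sub h2).const_mul _
  · rw [tendsto_pi_nhds]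
    intro q
    by_cases hq : q.2 ∈ labels
    · simp only [hF, lossDeriv, hq, if_true]
      have hd := (h_loss.differentiable q.2 hq q.1).hasDerivAt
      have ht := (hasDerivAt_iff_tendsto_slope_zero.1 hd).comp
        (g := fun t : ℝ => t⁻¹ • (loss (q.1 + t) q.2 - loss q.1 q.2))
        (f := fun n : ℕ => 1 / ((n : ℝ) + 1)) (x := Filter.atTop) ?_
      · refine ht.congr fun n => ?_
        simp
      · refine tendsto_nhdsWithin_iff.2 ⟨tendsto_one_div_add_atTop_nhds_zero_nat, ?_⟩
        exact Filter.Eventually.of_forall fun n => by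
          have : (0 : ℝ) < 1 / ((n : ℝ) + 1) := by positivity
          exact this.ne'
    · simp only [hF, lossDeriv, hq, if_false]
      exact tendsto_const_nhds

lemma tangent_le {f : ℝ → ℝ} (hf : ConvexOn ℝ Set.univ f) (hd : Differentiable ℝ f) (a b : ℝ) :
    f a + deriv f a * (b - a) ≤ f b := by
  rcases lt_trichotomy a b with h | h | h
  · have := hf.le_slope_of_hasDerivAt (Set.mem_univ a) (Set.mem_univ b) h (hd a).hasDerivAt
    rw [slope_def_field, le_div_iff₀ (by linarith)] at this
    linarith
  · simp [h]
  · have := hf.slope_le_of_hasDerivAt (Set.mem_univ b) (Set.mem_univ a) h (hd a).hasDerivAt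
    rw [slope_def_field, div_le_iff₀ (by linarith)] at this
    linarith

/-- The `j`-th coordinate of the sample gradient, set to zero for improper labels. -/
noncomputable def gradCoord {d : ℕ} (labels : Set ℝ) (loss : ℝ → ℝ → ℝ) (j : Fin d) (θ : E d)
    (z : E d × ℝ) : ℝ :=
  lossDeriv labels loss (inner ℝ θ z.1, z.2) * z.1 j

lemma gradCoord_of_mem {d : ℕ} {labels : Set ℝ} {loss : ℝ → ℝ → ℝ} (j : Fin d) (θ : E d)
    {z : E d × ℝ} (h : z.2 ∈ labels) :
    gradCoord labels loss j θ z = gradSample loss θ z j := by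
  rw [gradCoord, lossDeriv_of_mem h, gradSample, PiLp.smul_apply, smul_eq_mul]

lemma measurable_gradCoord {d : ℕ} {labels : Set ℝ} (h_labels : MeasurableSet labels)
    {loss : ℝ → ℝ → ℝ} (h_loss : IsAdmissibleLoss labels loss) (j : Fin d) :
    Measurable fun q : E d × (E d × ℝ) => gradCoord labels loss j q.1 q.2 := by
  refine ((measurable_lossDeriv h_labels h_loss).comp (Measurable.prodMk ?_ ?_)).mul ?_
  · exact measurable_fst.inner (measurable_fst.comp measurable_snd)
  · exact measurable_snd.comp measurable_snd
  · have : Measurable fun x : E d => x j := by fun_prop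
    exact this.comp (measurable_fst.comp measurable_snd)

/-! ### The objective -/

section Objective

variable {d : ℕ} {labels : Set ℝ} {loss : ℝ → ℝ → ℝ} {P : Measure (E d × ℝ)}

lemma measurable_gradCoord_right (h_labels : MeasurableSet labels)
    (h_loss : IsAdmissibleLoss labels loss) (j : Fin d) (θ : E d) :
    Measurable fun z => gradCoord labels loss j θ z :=
  Measurable.comp (g := fun q : E d × (E d × ℝ) => gradCoord labels loss j q.1 q.2)
    (f := fun z => (θ, z)) (measurable_gradCoord h_labels h_loss j) measurable_prodMk_left

lemma integrable_norm_sq (hP : IsAdmissibleLaw labels P) :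
    Integrable (fun z : E d × ℝ => ‖z.1‖ ^ 2) P := by
  have := hP.prob
  refine ((integrable_const (1 : ℝ)).add hP.moment_X).mono' (by fun_prop) ?_
  refine Filter.Eventually.of_forall fun z => ?_
  rw [Real.norm_of_nonneg (by positivity)]
  simp only [Pi.add_apply]
  nlinarith [sq_nonneg (‖z.1‖ ^ 2 - 1)]

lemma integrable_loss (h_loss : IsAdmissibleLoss labels loss)
    (hP : IsAdmissibleLaw labels P) (θ : E d) :
    Integrable (fun z : E d × ℝ => loss (inner ℝ θ z.1) z.2) P := by
  have := hP.prob
  obtain ⟨C₁, h1, C₂, h2, hg⟩ := h_loss.growth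
  have hdom : Integrable (fun z : E d × ℝ =>
      C₁ + C₂ * (2 * (‖θ‖ ^ 2 * ‖z.1‖ ^ 2) + 2 * |z.2| ^ 2)) P :=
    (integrable_const C₁).add (((((integrable_norm_sq hP).const_mul _).const_mul 2).add
      (hP.moment_Y.const_mul 2)).const_mul C₂)
  refine hdom.mono' ?_ ?_
  · refine (h_loss.measurable.comp (Measurable.prodMk ?_ measurable_snd)).aestronglyMeasurable
    exact measurable_const.inner measurable_fst
  · filter_upwards [hP.mem_labels] with z hz
    refine (hg _ _ hz).trans ?_
    have hi : (inner ℝ θ z.1) ^ 2 ≤ ‖θ‖ ^ 2 * ‖z.1‖ ^ 2 := by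
      rw [← mul_pow]
      exact sq_le_sq' (by linarith [neg_le_of_abs_le (abs_real_inner_le_norm θ z.1)])
        (real_inner_le_norm _ _)
    have : |inner ℝ θ z.1 - z.2| ^ 2 ≤ 2 * (‖θ‖ ^ 2 * ‖z.1‖ ^ 2) + 2 * |z.2| ^ 2 := by
      rw [sq_abs, sq_abs]
      nlinarith [sq_nonneg (inner ℝ θ z.1 + z.2)]
    gcongr

/-- A uniform bound on the second moments of the coordinates of the sample gradient. -/
lemma exists_gradCoord_sq_bound (h_loss : IsAdmissibleLoss labels loss)
    (hP : IsAdmissibleLaw labels P) (M : ℝ) :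
    ∃ D : E d × ℝ → ℝ, Integrable D P ∧ ∀ θ : E d, ‖θ‖ ≤ M → ∀ j,
      ∀ᵐ z ∂P, gradCoord labels loss j θ z ^ 2 ≤ D z := by
  obtain ⟨C₁, h1, C₂, h2, hg⟩ := h_loss.deriv_growth
  refine ⟨fun z => 3 * (C₁ ^ 2 * ‖z.1‖ ^ 2 + C₂ ^ 2 * M ^ 2 * ‖z.1‖ ^ 4
    + C₂ ^ 2 * ‖z.2 • z.1‖ ^ 2), ?_, fun θ hθ j => ?_⟩
  · exact ((((integrable_norm_sq hP).const_mul _).add (hP.moment_X.const_mul _)).add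
      (hP.moment_YX.const_mul _)).const_mul 3
  · filter_upwards [hP.mem_labels] with z hz
    rw [gradCoord, lossDeriv_of_mem hz]
    have hd := hg (inner ℝ θ z.1) z.2 hz
    have hi : |inner ℝ θ z.1| ≤ M * ‖z.1‖ :=
      (abs_real_inner_le_norm _ _).trans (by gcongr)
    have hM : 0 ≤ M := (norm_nonneg θ).trans hθ
    have hj : |z.1 j| ≤ ‖z.1‖ := by simpa using PiLp.norm_apply_le z.1 j
    set D := deriv (fun t => loss t z.2) (inner ℝ θ z.1)
    have hD : |D| ≤ C₁ + C₂ * (M * ‖z.1‖) + C₂ * |z.2| := by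
      have := abs_sub (inner ℝ θ z.1) z.2
      nlinarith
    rw [← sq_abs, abs_mul, mul_pow]
    calc |D| ^ 2 * |z.1 j| ^ 2
        ≤ (C₁ + C₂ * (M * ‖z.1‖) + C₂ * |z.2|) ^ 2 * ‖z.1‖ ^ 2 := by gcongr
      _ ≤ (3 * (C₁ ^ 2 + (C₂ * (M * ‖z.1‖)) ^ 2 + (C₂ * |z.2|) ^ 2)) * ‖z.1‖ ^ 2 := by
          gcongr
          nlinarith [sq_nonneg (C₁ - C₂ * (M * ‖z.1‖)), sq_nonneg (C₁ - C₂ * |z.2|),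
            sq_nonneg (C₂ * (M * ‖z.1‖) - C₂ * |z.2|)]
      _ = _ := by
          rw [norm_smul, Real.norm_eq_abs]
          ring

lemma memLp_gradCoord (h_labels : MeasurableSet labels) (h_loss : IsAdmissibleLoss labels loss)
    (hP : IsAdmissibleLaw labels P) (j : Fin d) (θ : E d) :
    MemLp (gradCoord labels loss j θ) 2 P := by
  obtain ⟨D, hD, hb⟩ := exists_gradCoord_sq_bound h_loss hP ‖θ‖
  have hm := measurable_gradCoord_right h_labels h_loss j θ
  refine (memLp_two_iff_integrable_sq hm.aestronglyMeasurable).2 ?_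
  refine hD.mono' (hm.pow_const 2).aestronglyMeasurable ?_
  filter_upwards [hb θ le_rfl j] with z hz
  rwa [Real.norm_of_nonneg (sq_nonneg _)]

/-- The vector of the expectations of the coordinates of the sample gradient. -/
noncomputable def meanGrad (labels : Set ℝ) (loss : ℝ → ℝ → ℝ) (P : Measure (E d × ℝ)) (θ : E d) :
    E d :=
  WithLp.toLp 2 fun j => ∫ z, gradCoord labels loss j θ z ∂P

lemma integrable_gradCoord (h_labels : MeasurableSet labels)
    (h_loss : IsAdmissibleLoss labels loss) (hP : IsAdmissibleLaw labels P) (j : Fin d) (θ : E d) :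
    Integrable (gradCoord labels loss j θ) P := by
  have := hP.prob
  exact (memLp_gradCoord h_labels h_loss hP j θ).integrable one_le_two

lemma lossDeriv_mul_inner (θ v : E d) (z : E d × ℝ) :
    lossDeriv labels loss (inner ℝ θ z.1, z.2) * inner ℝ v z.1
      = ∑ j, gradCoord labels loss j θ z * v j := by
  simp only [gradCoord, PiLp.inner_apply, Finset.mul_sum]
  refine Finset.sum_congr rfl fun j _ => ?_
  simp only [RCLike.inner_apply, conj_trivial]
  ring

lemma integrable_lossDeriv_mul_inner (h_labels : MeasurableSet labels)
    (h_loss : IsAdmissibleLoss labels loss) (hP : IsAdmissibleLaw labels P) (θ v : E d) :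
    Integrable (fun z => lossDeriv labels loss (inner ℝ θ z.1, z.2) * inner ℝ v z.1) P := by
  simp only [lossDeriv_mul_inner]
  exact integrable_finsetSum _ fun j _ =>
    (integrable_gradCoord h_labels h_loss hP j θ).mul_const _

lemma inner_meanGrad (h_labels : MeasurableSet labels)
    (h_loss : IsAdmissibleLoss labels loss) (hP : IsAdmissibleLaw labels P) (θ v : E d) :
    inner ℝ (meanGrad labels loss P θ) v
      = ∫ z, lossDeriv labels loss (inner ℝ θ z.1, z.2) * inner ℝ v z.1 ∂P := by
  simp only [lossDeriv_mul_inner]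
  rw [integral_finsetSum _ fun j _ =>
    (integrable_gradCoord h_labels h_loss hP j θ).mul_const _, PiLp.inner_apply]
  refine Finset.sum_congr rfl fun j _ => ?_
  rw [integral_mul_const]
  simp [meanGrad, mul_comm]

lemma objective_sub_sub (h_labels : MeasurableSet labels)
    (h_loss : IsAdmissibleLoss labels loss) (hP : IsAdmissibleLaw labels P) (θ θ' : E d) :
    objective P loss θ' - objective P loss θ - inner ℝ (meanGrad labels loss P θ) (θ' - θ)
      = ∫ z, (loss (inner ℝ θ' z.1) z.2 - loss (inner ℝ θ z.1) z.2
        - lossDeriv labels loss (inner ℝ θ z.1, z.2) * inner ℝ (θ' - θ) z.1) ∂P := by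
  have h1 := integrable_loss h_loss hP θ'
  have h2 := integrable_loss h_loss hP θ
  have h3 := integrable_lossDeriv_mul_inner h_labels h_loss hP θ (θ' - θ)
  have h12 : Integrable
      (fun z : E d × ℝ => loss (inner ℝ θ' z.1) z.2 - loss (inner ℝ θ z.1) z.2) P := h1.sub h2
  rw [integral_sub h12 h3, integral_sub h1 h2, inner_meanGrad h_labels h_loss hP]
  rfl

lemma objective_tangent_le (h_labels : MeasurableSet labels)
    (h_loss : IsAdmissibleLoss labels loss) (hP : IsAdmissibleLaw labels P) (θ θ' : E d) :
    objective P loss θ + inner ℝ (meanGrad labels loss P θ) (θ' - θ) ≤ objective P loss θ' := by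
  have h := objective_sub_sub h_labels h_loss hP θ θ'
  have hnn : 0 ≤ ∫ z, (loss (inner ℝ θ' z.1) z.2 - loss (inner ℝ θ z.1) z.2
        - lossDeriv labels loss (inner ℝ θ z.1, z.2) * inner ℝ (θ' - θ) z.1) ∂P := by
    refine integral_nonneg_of_ae ?_
    filter_upwards [hP.mem_labels] with z hz
    rw [lossDeriv_of_mem hz, inner_sub_left]
    have := tangent_le (h_loss.convex _ hz) (h_loss.differentiable _ hz)
      (inner ℝ θ z.1) (inner ℝ θ' z.1)
    simp only [Pi.zero_apply]
    linarith
  linarith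

/-- No differentiation under the integral is needed. The first-order remainder is the expectation of
pointwise remainders, which convexity bounds below by `0` and smoothness of the loss above by `γ ‖θ'
- θ‖² ‖X‖²`; so it is quadratic. -/
lemma hasGradientAt_objective (h_labels : MeasurableSet labels)
    (h_loss : IsAdmissibleLoss labels loss) (hP : IsAdmissibleLaw labels P) (θ : E d) :
    HasGradientAt (objective P loss) (meanGrad labels loss P θ) θ := by
  obtain ⟨γ, hγ, hsm⟩ := h_loss.smooth
  rw [hasGradientAt_iff_isLittleO]
  refine Asymptotics.IsBigO.trans_isLittleO ?_
    (Asymptotics.isLittleO_pow_sub_sub θ (m := 2) one_lt_two)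
  refine Asymptotics.IsBigO.of_bound (γ * ∫ z, ‖z.1‖ ^ 2 ∂P) (Filter.Eventually.of_forall ?_)
  intro θ'
  have hnn := objective_tangent_le h_labels h_loss hP θ θ'
  rw [Real.norm_of_nonneg (by linarith), objective_sub_sub h_labels h_loss hP,
    Real.norm_of_nonneg (by positivity), mul_right_comm, ← integral_const_mul]
  have h1 := integrable_loss h_loss hP θ'
  have h2 := integrable_loss h_loss hP θ
  have h3 := integrable_lossDeriv_mul_inner h_labels h_loss hP θ (θ' - θ)
  refine integral_mono_ae ((h1.sub h2).sub h3) ((integrable_norm_sq hP).const_mul _) ?_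
  filter_upwards [hP.mem_labels] with z hz
  rw [lossDeriv_of_mem hz, inner_sub_left]
  -- The tangent is taken at the far point `θ'`, which turns the remainder into a difference of
  -- derivatives times the increment.
  have ht := tangent_le (h_loss.convex _ hz) (h_loss.differentiable _ hz)
    (inner ℝ θ' z.1) (inner ℝ θ z.1)
  have hs := hsm z.2 hz (inner ℝ θ' z.1) (inner ℝ θ z.1)
  have hi : (inner ℝ θ' z.1 - inner ℝ θ z.1) ^ 2 ≤ ‖θ' - θ‖ ^ 2 * ‖z.1‖ ^ 2 := by
    rw [← inner_sub_left, ← mul_pow]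
    exact sq_le_sq' (by linarith [neg_le_of_abs_le (abs_real_inner_le_norm (θ' - θ) z.1)])
      (real_inner_le_norm _ _)
  set a := inner ℝ θ z.1
  set b := inner ℝ θ' z.1
  set Da := deriv (fun t => loss t z.2) a
  set Db := deriv (fun t => loss t z.2) b
  calc loss b z.2 - loss a z.2 - Da * (b - a) ≤ (Db - Da) * (b - a) := by linarith
    _ ≤ |Db - Da| * |b - a| := by rw [← abs_mul]; exact le_abs_self _
    _ ≤ γ * |b - a| * |b - a| := by gcongr
    _ = γ * (b - a) ^ 2 := by rw [mul_assoc, abs_mul_abs_self, sq]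
    _ ≤ γ * (‖θ' - θ‖ ^ 2 * ‖z.1‖ ^ 2) := by gcongr
    _ = _ := by ring

/-- On the parameter set, the variances of the coordinates of the sample gradient are at most
`σ_max²`. -/
lemma integral_sq_gradCoord_sub_le (h_labels : MeasurableSet labels)
    (h_loss : IsAdmissibleLoss labels loss) (hP : IsAdmissibleLaw labels P) {Θ : Set (E d)}
    (hΘ : IsCompact Θ) {θ : E d} (hθ : θ ∈ Θ) (j : Fin d) :
    ∫ z, (gradCoord labels loss j θ z - meanGrad labels loss P θ j) ^ 2 ∂P
      ≤ sigmaMax P loss Θ ^ 2 := by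
  have := hP.prob
  obtain ⟨M, hM⟩ := hΘ.isBounded.exists_norm_le
  obtain ⟨D, hD, hb⟩ := exists_gradCoord_sq_bound h_loss hP M
  have hae : ∀ θ (j : Fin d),
      (fun z => gradSample loss θ z j) =ᵐ[P] gradCoord labels loss j θ := fun θ j => by
    filter_upwards [hP.mem_labels] with z hz
    rw [gradCoord_of_mem j θ hz]
  have hvar : ∀ θ (j : Fin d), variance (fun z => gradSample loss θ z j) P
      = variance (gradCoord labels loss j θ) P := fun θ j => variance_congr (hae θ j)
  -- Boundedness of `Θ` makes the supremum in `sigmaMax` genuine; an unbounded set would have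
  -- supremum `0` by default.
  have hbdd : BddAbove {v : ℝ | ∃ θ ∈ Θ, ∃ j : Fin d,
      v = variance (fun z => gradSample loss θ z j) P} := by
    refine ⟨∫ z, D z ∂P, ?_⟩
    rintro _ ⟨θ, hθ, j, rfl⟩
    rw [hvar]
    have hL := memLp_gradCoord h_labels h_loss hP j θ
    refine (variance_le_expectation_sq hL.aestronglyMeasurable).trans ?_
    exact integral_mono_ae hL.integrable_sq hD (hb θ (hM θ hθ) j)
  have hle : variance (gradCoord labels loss j θ) P ≤ sigmaMax P loss Θ ^ 2 := by
    rw [← hvar, sigmaMax, Real.sq_sqrt]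
    · exact le_csSup hbdd ⟨θ, hθ, j, rfl⟩
    · exact (variance_nonneg _ _).trans (le_csSup hbdd ⟨θ, hθ, j, rfl⟩)
  rwa [variance_eq_integral (memLp_gradCoord h_labels h_loss hP j θ).aemeasurable] at hle

end Objective

/-! ### Expected excess and lower quantiles -/

section Excess

variable {𝒵 : Type*} [MeasurableSpace 𝒵] {P : Measure 𝒵} {F : 𝒵 → ℝ}

/-- The expected amount by which `F` falls short of the level `x`. -/
noncomputable def shortfall (P : Measure 𝒵) (F : 𝒵 → ℝ) (x : ℝ) : ℝ := ∫ z, max (x - F z) 0 ∂P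

/-- The smallest level at which the expected shortfall is at least `c`. -/
noncomputable def shortfallLevel (P : Measure 𝒵) (F : 𝒵 → ℝ) (c : ℝ) : ℝ :=
  sInf {x | c ≤ shortfall P F x}

variable [IsProbabilityMeasure P]

lemma integrable_max_sub (hF : MemLp F 2 P) (x : ℝ) : Integrable (fun z => max (x - F z) 0) P :=
  ((integrable_const x).sub (hF.integrable one_le_two)).pos_part

lemma shortfall_mono (hF : MemLp F 2 P) : Monotone (shortfall P F) := fun x y hxy =>
  integral_mono (integrable_max_sub hF x) (integrable_max_sub hF y) fun z =>
    max_le_max (by simpa using hxy) le_rfl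

lemma continuous_shortfall (hF : MemLp F 2 P) : Continuous (shortfall P F) := by
  refine (LipschitzWith.of_le_add fun x y => ?_ : LipschitzWith 1 (shortfall P F)).continuous
  have h : shortfall P F x ≤ ∫ z, (max (y - F z) 0 + dist x y) ∂P := by
    refine integral_mono (integrable_max_sub hF x)
      ((integrable_max_sub hF y).add (integrable_const _)) fun z => ?_
    have h1 : x - y ≤ dist x y := le_abs_self _
    refine max_le ?_ ?_
    · linarith [le_max_left (y - F z) 0]
    · exact add_nonneg (le_max_right _ _) dist_nonneg
  rwa [integral_add (integrable_max_sub hF y) (integrable_const _), integral_const, probReal_univ,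
    one_smul] at h

lemma le_shortfall (hF : MemLp F 2 P) (h0 : ∫ z, F z ∂P = 0) (x : ℝ) : x ≤ shortfall P F x := by
  have hi := hF.integrable one_le_two
  calc x = ∫ z, (x - F z) ∂P := by
        rw [integral_sub (integrable_const _) hi, h0, integral_const, probReal_univ]; simp
    _ ≤ _ := integral_mono ((integrable_const x).sub hi) (integrable_max_sub hF x)
        fun z => le_max_left _ _

lemma shortfall_neg_le (hF : MemLp F 2 P) {M : ℝ} (hM : 0 < M) :
    shortfall P F (-M) ≤ (∫ z, F z ^ 2 ∂P) / (4 * M) := by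
  rw [div_eq_mul_inv, ← integral_mul_const]
  refine integral_mono (integrable_max_sub hF _) (hF.integrable_sq.mul_const _) fun z => ?_
  simp only
  rw [← div_eq_mul_inv]
  refine max_le ?_ (by positivity)
  rw [le_div_iff₀ (by positivity)]
  nlinarith [sq_nonneg (F z + 2 * M)]

/-- The shortfall at `-M` is at most `𝔼 F² / (4 M)`, hence below `c` for large `M`. -/
lemma bddBelow_shortfall (hF : MemLp F 2 P) {c : ℝ} (hc : 0 < c) :
    BddBelow {x | c ≤ shortfall P F x} := by
  set V := ∫ z, F z ^ 2 ∂P with hV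
  have hV0 : 0 ≤ V := integral_nonneg fun z => sq_nonneg _
  set M := (V + 1) / c with hM
  have hMpos : 0 < M := by positivity
  refine ⟨-M, fun x hx => ?_⟩
  by_contra! hlt
  have h1 : c ≤ V / (4 * M) :=
    (le_trans hx (shortfall_mono hF hlt.le)).trans (shortfall_neg_le hF hMpos)
  rw [le_div_iff₀ (by positivity)] at h1
  have h2 : c * M = V + 1 := by rw [hM]; field_simp
  nlinarith

/-- By continuity the infimum is attained. Sublevel sets of the level thus become superlevel sets of
an integral, which makes the level measurable in a parameter; a quantile would not allow this so
directly. -/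
lemma shortfallLevel_le_iff (hF : MemLp F 2 P) (h0 : ∫ z, F z ∂P = 0) {c : ℝ} (hc : 0 < c)
    {x : ℝ} : shortfallLevel P F c ≤ x ↔ c ≤ shortfall P F x := by
  have hne : {x | c ≤ shortfall P F x}.Nonempty := ⟨c, le_shortfall hF h0 c⟩
  have hcl : IsClosed {x | c ≤ shortfall P F x} :=
    isClosed_le continuous_const (continuous_shortfall hF)
  have hmem : c ≤ shortfall P F (shortfallLevel P F c) :=
    hcl.csInf_mem hne (bddBelow_shortfall hF hc)
  exact ⟨fun h => hmem.trans (shortfall_mono hF h), fun h => csInf_le (bddBelow_shortfall hF hc) h⟩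

lemma shortfallLevel_le (hF : MemLp F 2 P) (h0 : ∫ z, F z ∂P = 0) {c : ℝ} (hc : 0 < c) :
    shortfallLevel P F c ≤ c :=
  (shortfallLevel_le_iff hF h0 hc).2 (le_shortfall hF h0 c)

lemma shortfall_shortfallLevel (hF : MemLp F 2 P) (h0 : ∫ z, F z ∂P = 0) {c : ℝ} (hc : 0 < c) :
    shortfall P F (shortfallLevel P F c) = c := by
  refine le_antisymm ?_ ((shortfallLevel_le_iff hF h0 hc).1 le_rfl)
  set b := shortfallLevel P F c
  have ht : Filter.Tendsto (shortfall P F) (nhdsWithin b (Set.Iio b)) (nhds (shortfall P F b)) :=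
    ((continuous_shortfall hF).tendsto b).mono_left nhdsWithin_le_nhds
  refine le_of_tendsto ht ?_
  filter_upwards [self_mem_nhdsWithin] with x hx
  by_contra! h
  exact absurd ((shortfallLevel_le_iff hF h0 hc).2 h.le) (not_le.2 hx)

/-- A level with a large expected shortfall is exceeded with small probability. -/
lemma sq_div_le_measure_le (hFm : Measurable F) (hF : MemLp F 2 P) (h0 : ∫ z, F z ∂P = 0)
    {σ c b : ℝ} (hσ : 0 < σ) (hvar : ∫ z, F z ^ 2 ∂P ≤ σ ^ 2) (hc : 0 < c)
    (hb : shortfall P F b = c) :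
    c ^ 2 / (c ^ 2 + σ ^ 2) ≤ P.real {z | F z ≤ b} := by
  set A : Set 𝒵 := {z | F z ≤ b} with hA
  have hAm : MeasurableSet A := measurableSet_le hFm measurable_const
  set q := P.real A with hq
  set D := c ^ 2 + σ ^ 2 with hD
  have hDpos : 0 < D := by positivity
  set s := D / c with hs
  have hspos : 0 < s := by positivity
  have hi := hF.integrable one_le_two
  have hiA : Integrable (A.indicator F) P := hi.indicator hAm
  have hi1 : Integrable (A.indicator fun _ => (1 : ℝ)) P := (integrable_const 1).indicator hAm
  have hI1 : ∫ z, A.indicator (fun _ => (1 : ℝ)) z ∂P = q := by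
    rw [integral_indicator_const _ hAm, smul_eq_mul, mul_one]
  have hIA : ∫ z, A.indicator F z ∂P = b * q - c := by
    have e : ∀ z, max (b - F z) 0 = b * A.indicator (fun _ => (1 : ℝ)) z - A.indicator F z := by
      intro z
      by_cases hz : z ∈ A
      · have : F z ≤ b := hz
        simp [hz, this]
      · have : b < F z := not_le.1 hz
        simp [hz, this.le]
    have : c = ∫ z, (b * A.indicator (fun _ => (1 : ℝ)) z - A.indicator F z) ∂P := by
      rw [← hb, shortfall]; simp only [e]
    rw [integral_sub (hi1.const_mul b) hiA, integral_const_mul, hI1] at this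
    linarith
  have hbc : b ≤ c := hb ▸ le_shortfall hF h0 b
  -- Cauchy–Schwarz for `F` against `q - 1_A`, in linearized form: integrate `(F - s (q - 1_A))² ≥
  -- 0`, using `𝔼 F = 0` and `𝔼 F 1_A = b q - c`. With `b ≤ c` this would contradict `q < c² / D`.
  have key : 2 * s * (c - b * q) - s ^ 2 * (q * (1 - q)) ≤ σ ^ 2 := by
    refine le_trans ?_ hvar
    have hI : ∫ z, (2 * s * (q * F z - A.indicator F z)
        - s ^ 2 * (q ^ 2 + (1 - 2 * q) * A.indicator (fun _ => (1 : ℝ)) z)) ∂P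
        = 2 * s * (c - b * q) - s ^ 2 * (q * (1 - q)) := by
      have i1 : Integrable (fun z => 2 * s * (q * F z - A.indicator F z)) P :=
        ((hi.const_mul q).sub hiA).const_mul _
      have i2 : Integrable
          (fun z => s ^ 2 * (q ^ 2 + (1 - 2 * q) * A.indicator (fun _ => (1 : ℝ)) z)) P :=
        ((integrable_const _).add (hi1.const_mul _)).const_mul _
      rw [integral_sub i1 i2, integral_const_mul,
        integral_const_mul, integral_sub (hi.const_mul q) hiA,
        integral_add (integrable_const _) (hi1.const_mul _), integral_const_mul,
        integral_const_mul, hI1, hIA, h0, integral_const, probReal_univ]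
      simp only [one_smul]
      ring
    rw [← hI]
    refine integral_mono ((((hi.const_mul q).sub hiA).const_mul _).sub
        (((integrable_const _).add (hi1.const_mul _)).const_mul _)) hF.integrable_sq fun z => ?_
    by_cases hz : z ∈ A
    · simp only [hz, Set.indicator_of_mem]
      nlinarith [sq_nonneg (F z - s * (q - 1))]
    · simp only [hz, not_false_eq_true, Set.indicator_of_notMem]
      nlinarith [sq_nonneg (F z - s * q)]
  by_contra! hlt
  have hq0 : 0 ≤ q := measureReal_nonneg
  rw [lt_div_iff₀ hDpos] at hlt
  have hq1 : q < 1 := by nlinarith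
  have e1 : s * c = D := by rw [hs]; field_simp
  have e2 : c * (1 - q) ≤ c - b * q := by nlinarith
  have e3 : σ ^ 2 < D * (1 - q) := by linarith
  have e4 : s ^ 2 * q < D := by
    have : s ^ 2 * q * c ^ 2 = D ^ 2 * q := by rw [← e1]; ring
    have : D ^ 2 * q < D * c ^ 2 := by nlinarith
    nlinarith [pow_pos hc 2]
  have e5 : 2 * s * (c * (1 - q)) - s ^ 2 * (q * (1 - q)) ≤ σ ^ 2 := by
    have := mul_le_mul_of_nonneg_left e2 hspos.le
    linarith
  have e6 : 2 * s * (c * (1 - q)) - s ^ 2 * (q * (1 - q)) = (2 * D - s ^ 2 * q) * (1 - q) := by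
    rw [← e1]; ring
  rw [e6] at e5
  nlinarith

end Excess

/-! ### Chernoff bounds -/

/-- The exponential parameter is absorbed into `G`. The upper bound `C` serves only for
integrability and does not enter the estimate. -/
lemma chernoff_sum {Ω 𝒵 ι : Type*} [MeasurableSpace Ω] [MeasurableSpace 𝒵] {μ : Measure Ω}
    [IsProbabilityMeasure μ] {P : Measure 𝒵} {W : ι → Ω → 𝒵} (hW : ∀ i, Measurable (W i))
    (hind : iIndepFun W μ) (hlaw : ∀ i, μ.map (W i) = P) {G : 𝒵 → ℝ} (hG : Measurable G) {C : ℝ}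
    (hC : ∀ z, G z ≤ C) {a : ℝ} (ha : ∫ z, Real.exp (G z) ∂P ≤ Real.exp a) (I : Finset ι) (s : ℝ) :
    μ.real {w | s ≤ ∑ i ∈ I, G (W i w)} ≤ Real.exp (I.card * a - s) := by
  have hGW : ∀ i, Measurable fun w => G (W i w) := fun i => hG.comp (hW i)
  have hindG : iIndepFun (fun i w => G (W i w)) μ := hind.comp (fun _ => G) fun _ => hG
  have hmgf : ∀ i, mgf (fun w => G (W i w)) μ 1 ≤ Real.exp a := by
    intro i
    rw [mgf]
    simp only [one_mul]
    refine le_trans (le_of_eq ?_) ha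
    rw [← hlaw i, integral_map (hW i).aemeasurable (hG.exp.aestronglyMeasurable)]
  have hsum : (fun w => ∑ i ∈ I, G (W i w)) = ∑ i ∈ I, fun w => G (W i w) := by
    ext w; simp
  have hint : Integrable (fun w => Real.exp (1 * ∑ i ∈ I, G (W i w))) μ := by
    refine (integrable_const (Real.exp (I.card * C))).mono'
      (((Finset.measurable_fun_sum I fun i _ => hGW i).const_mul 1).exp).aestronglyMeasurable
      (Filter.Eventually.of_forall fun w => ?_)
    rw [Real.norm_of_nonneg (Real.exp_pos _).le, one_mul, ← nsmul_eq_mul]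
    exact Real.exp_le_exp.2 (Finset.sum_le_card_nsmul _ _ _ fun i _ => hC _)
  refine (measure_ge_le_exp_mul_mgf s zero_le_one hint).trans ?_
  rw [hsum, hindG.mgf_sum hGW I, sub_eq_add_neg, add_comm, Real.exp_add, neg_mul, one_mul]
  refine mul_le_mul_of_nonneg_left ?_ (Real.exp_pos _).le
  calc ∏ i ∈ I, mgf (fun w => G (W i w)) μ 1 ≤ ∏ _i ∈ I, Real.exp a :=
        Finset.prod_le_prod (fun i _ => mgf_nonneg) fun i _ => hmgf i
    _ = Real.exp (I.card * a) := by rw [Finset.prod_const, ← Real.exp_nat_mul]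

lemma exp_le_one_add_sq {x : ℝ} (hx : x ≤ 1) : Real.exp x ≤ 1 + x + x ^ 2 := by
  rcases le_total (-1) x with h | h
  · have := (abs_le.1 (Real.abs_exp_sub_one_sub_id_le (abs_le.2 ⟨h, hx⟩))).2
    linarith
  · have : Real.exp x ≤ 1 := Real.exp_le_one_iff.2 (by linarith)
    nlinarith

lemma abs_clip_sub_clip_zero_le (b B y : ℝ) :
    |min (max b y) B - min (max b 0) B| ≤ |y| := by
  refine (abs_min_sub_min_le_max _ _ _ _).trans ?_
  simp only [sub_self, abs_zero]
  refine max_le ((abs_max_sub_max_le_max _ _ _ _).trans ?_) (abs_nonneg _)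
  simp

/-- Bound on the exponential moment of a clipped variable. -/
lemma integral_exp_clip_le {𝒵 : Type*} [MeasurableSpace 𝒵] {P : Measure 𝒵}
    [IsProbabilityMeasure P] {F : 𝒵 → ℝ} (hFm : Measurable F) (hF : MemLp F 2 P)
    (h0 : ∫ z, F z ∂P = 0) {σ b B lam : ℝ} (hvar : ∫ z, F z ^ 2 ∂P ≤ σ ^ 2) (hB : 0 ≤ B)
    (hlam : 0 ≤ lam) (hlamB : lam * B ≤ 1) :
    ∫ z, Real.exp (lam * min (max b (F z)) B) ∂P
      ≤ Real.exp (lam * shortfall P F b + lam ^ 2 * σ ^ 2) := by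
  have hi := hF.integrable one_le_two
  -- Subtracting the clipped value of `0` leaves a variable dominated by `|F|`, so its second moment
  -- is at most `σ²` wherever `b` lies.
  set φ₀ := min (max b 0) B with hφ₀
  have hφ₀nn : 0 ≤ φ₀ := le_min (le_max_right _ _) hB
  set ψ : 𝒵 → ℝ := fun z => min (max b (F z)) B - φ₀ with hψ
  have hψm : Measurable ψ := ((measurable_const.max hFm).min measurable_const).sub_const _
  have hψF : ∀ z, |ψ z| ≤ |F z| := fun z => abs_clip_sub_clip_zero_le b B (F z)
  have hψi : Integrable ψ P := hi.mono hψm.aestronglyMeasurable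
    (Filter.Eventually.of_forall fun z => hψF z)
  have hmean : ∫ z, ψ z ∂P ≤ shortfall P F b - φ₀ := by
    have hs : shortfall P F b - φ₀ = ∫ z, (F z + max (b - F z) 0 - φ₀) ∂P := by
      have h12 : Integrable (fun z => F z + max (b - F z) 0) P := hi.add (integrable_max_sub hF b)
      rw [integral_sub h12 (integrable_const _), integral_add hi (integrable_max_sub hF b), h0,
        integral_const, probReal_univ, shortfall]
      simp
    rw [hs]
    refine integral_mono hψi ((hi.add (integrable_max_sub hF b)).sub (integrable_const _))
      fun z => ?_
    -- Clipping above only lowers the variable, and clipping below at `b` adds exactly the pointwise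
    -- shortfall.
    have : min (max b (F z)) B ≤ F z + max (b - F z) 0 := by
      refine (min_le_left _ _).trans (max_le ?_ ?_)
      · linarith [le_max_left (b - F z) 0]
      · linarith [le_max_right (b - F z) 0]
    simp only [hψ]
    linarith
  have hpt : ∀ z, Real.exp (lam * min (max b (F z)) B)
      ≤ Real.exp (lam * φ₀) * (1 + lam * ψ z + lam ^ 2 * F z ^ 2) := by
    intro z
    have e : lam * min (max b (F z)) B = lam * φ₀ + lam * ψ z := by simp only [hψ]; ring
    rw [e, Real.exp_add]
    refine mul_le_mul_of_nonneg_left ?_ (Real.exp_pos _).le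
    have h1 : lam * ψ z ≤ 1 := by
      refine le_trans (mul_le_mul_of_nonneg_left ?_ hlam) hlamB
      have := min_le_right (max b (F z)) B
      simp only [hψ]
      linarith
    refine (exp_le_one_add_sq h1).trans ?_
    have h2 : ψ z ^ 2 ≤ F z ^ 2 := sq_le_sq.2 (hψF z)
    have := mul_le_mul_of_nonneg_left h2 (sq_nonneg lam)
    linarith [mul_pow lam (ψ z) 2]
  have hdom : Integrable
      (fun z => Real.exp (lam * φ₀) * (1 + lam * ψ z + lam ^ 2 * F z ^ 2)) P :=
    (((integrable_const _).add (hψi.const_mul _)).add (hF.integrable_sq.const_mul _)).const_mul _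
  have hexp_int : Integrable (fun z => Real.exp (lam * min (max b (F z)) B)) P := by
    refine hdom.mono' (((measurable_const.max hFm).min measurable_const).const_mul _
      |>.exp.aestronglyMeasurable) (Filter.Eventually.of_forall fun z => ?_)
    rw [Real.norm_of_nonneg (Real.exp_pos _).le]
    exact hpt z
  calc _ ≤ ∫ z, Real.exp (lam * φ₀) * (1 + lam * ψ z + lam ^ 2 * F z ^ 2) ∂P :=
        integral_mono hexp_int hdom hpt
    _ = Real.exp (lam * φ₀) * (1 + lam * ∫ z, ψ z ∂P + lam ^ 2 * ∫ z, F z ^ 2 ∂P) := by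
        have h12 : Integrable (fun z => 1 + lam * ψ z) P :=
          (integrable_const _).add (hψi.const_mul _)
        rw [integral_const_mul, integral_add h12 (hF.integrable_sq.const_mul _),
          integral_add (integrable_const _) (hψi.const_mul _), integral_const_mul,
          integral_const_mul, integral_const, probReal_univ, one_smul]
    _ ≤ Real.exp (lam * φ₀) * Real.exp (lam * (shortfall P F b - φ₀) + lam ^ 2 * σ ^ 2) := by
        refine mul_le_mul_of_nonneg_left ?_ (Real.exp_pos _).le
        refine le_trans ?_ (Real.add_one_le_exp _)
        have := mul_le_mul_of_nonneg_left hmean hlam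
        have := mul_le_mul_of_nonneg_left hvar (sq_nonneg lam)
        linarith
    _ = _ := by
        rw [← Real.exp_add]
        congr 1
        ring

/-- For an event of probability at least `9 a / (1 + 9 a)`, this turns the exponential moment `1 - q
/ 2` of the count at parameter `-log 2` into a bound `exp (-a)`. -/
lemma exp_le_of_le_half {a : ℝ} (h0 : 0 ≤ a) (h1 : a ≤ 1 / 2) :
    Real.exp a * (1 + 9 / 2 * a) ≤ 1 + 9 * a := by
  have h := Real.exp_bound' h0 (by linarith) (n := 2) (by norm_num)
  norm_num [Finset.sum_range_succ, Nat.factorial] at h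
  have h2 : Real.exp a ≤ 1 + a + 3 / 4 * a ^ 2 := by linarith
  calc Real.exp a * (1 + 9 / 2 * a) ≤ (1 + a + 3 / 4 * a ^ 2) * (1 + 9 / 2 * a) := by gcongr
    _ ≤ 1 + 9 * a := by nlinarith [mul_nonneg h0 (sub_nonneg.2 h1), mul_nonneg h0 h0]

/-- The samples of the two halves behave well above their mean: few values of the first half
exceed `B`, many are at most `b`, and the sum of the clipped values of the second half is at
most `S`. -/
structure SideGood {ι : Type*} (I₁ I₂ : Finset ι) (b B s₁ s₂ S : ℝ) (y : ι → ℝ) : Prop where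
  many_le : s₁ ≤ ∑ i ∈ I₁, if y i ≤ b then (1 : ℝ) else 0
  few_gt : ∑ i ∈ I₁, (if B < y i then (1 : ℝ) else 0) ≤ s₂
  sum_le : ∑ i ∈ I₂, min (max b (y i)) B ≤ S

/-! ### Deviation bounds at a fixed point, for one coordinate and one sign. -/

section SideGood

variable {Ω 𝒵 ι : Type*} [MeasurableSpace Ω] [MeasurableSpace 𝒵] {μ : Measure Ω}
    [IsProbabilityMeasure μ] {P : Measure 𝒵} [IsProbabilityMeasure P] {W : ι → Ω → 𝒵}
    {F : 𝒵 → ℝ} {σ α h Λ N : ℝ}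

/-- A Chernoff bound for the lower tail at parameter `-log 2`: at least `N - h` samples each
contribute a factor `exp (-α)`, and `α N = 4 h + 6 Λ` outweighs `log 2 * (α N + 2)` by `Λ + 2/5`. -/
lemma measure_few_le (hW : ∀ i, Measurable (W i))
    (hind : iIndepFun W μ) (hlaw : ∀ i, μ.map (W i) = P)
    (hFm : Measurable F) (hh : 0 ≤ h) (hΛ : 23 / 10 ≤ Λ) (hα0 : 0 ≤ α) (hα1 : α ≤ 1 / 2)
    (hαN : α * N = 4 * h + 6 * Λ) {b : ℝ} (hb : 9 * α / (1 + 9 * α) ≤ P.real {z | F z ≤ b})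
    {I : Finset ι} (hI : N - h ≤ I.card) :
    μ.real {w | ∑ i ∈ I, (if F (W i w) ≤ b then (1 : ℝ) else 0) < α * N + 2}
      ≤ 3 / 4 * Real.exp (-Λ) := by
  set l := Real.log 2 with hl
  have hl2 : l < 0.6931471808 := Real.log_two_lt_d9
  have hl1 : 0.6931471803 < l := Real.log_two_gt_d9
  have hAm : MeasurableSet {z | F z ≤ b} := measurableSet_le hFm measurable_const
  have hint : ∫ z, Real.exp (if F z ≤ b then -l else 0) ∂P ≤ Real.exp (-α) := by
    have e : ∀ z, Real.exp (if F z ≤ b then -l else 0)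
        = 1 - 1 / 2 * ({z | F z ≤ b} : Set 𝒵).indicator (fun _ => (1 : ℝ)) z := by
      intro z
      by_cases hz : F z ≤ b
      · have : z ∈ ({z | F z ≤ b} : Set 𝒵) := hz
        rw [if_pos hz, Set.indicator_of_mem this, Real.exp_neg, hl, Real.exp_log two_pos]
        norm_num
      · have : z ∉ ({z | F z ≤ b} : Set 𝒵) := hz
        rw [if_neg hz, Set.indicator_of_notMem this]
        simp
    simp only [e]
    rw [integral_sub (integrable_const _)
      (((integrable_const (1 : ℝ)).indicator hAm).const_mul _), integral_const_mul,
      integral_indicator_const _ hAm, integral_const, probReal_univ]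
    have h9 : 0 < 1 + 9 * α := by linarith
    rw [Real.exp_neg, one_smul, smul_eq_mul, mul_one]
    have h1 : 1 - 1 / 2 * P.real {z | F z ≤ b} ≤ (1 + 9 / 2 * α) / (1 + 9 * α) := by
      have : (1 + 9 / 2 * α) / (1 + 9 * α) = 1 - 1 / 2 * (9 * α / (1 + 9 * α)) := by
        field_simp; ring
      rw [this]
      linarith
    refine h1.trans ?_
    rw [div_le_iff₀ h9, inv_mul_eq_div, le_div_iff₀ (Real.exp_pos _), mul_comm]
    exact exp_le_of_le_half hα0 hα1
  have hch := chernoff_sum hW hind hlaw (G := fun z => if F z ≤ b then -l else 0)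
    (Measurable.ite hAm measurable_const measurable_const) (C := 0)
    (fun z => by split_ifs <;> linarith) hint I (-(l * (α * N + 2)))
  refine (measureReal_mono fun w hw => ?_).trans (hch.trans ?_)
  · have e : ∑ i ∈ I, (if F (W i w) ≤ b then -l else 0)
        = -(l * ∑ i ∈ I, if F (W i w) ≤ b then (1 : ℝ) else 0) := by
      rw [Finset.mul_sum, ← Finset.sum_neg_distrib]
      exact Finset.sum_congr rfl fun i _ => by split_ifs <;> simp
    have hw' : ∑ i ∈ I, (if F (W i w) ≤ b then (1 : ℝ) else 0) < α * N + 2 := hw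
    change -(l * (α * N + 2)) ≤ ∑ i ∈ I, (if F (W i w) ≤ b then -l else 0)
    rw [e]
    nlinarith
  · have h1 : (I.card : ℝ) * -α - -(l * (α * N + 2)) ≤ -Λ + -(2 / 5) := by
      have h2 : (N - h) * α ≤ I.card * α := by gcongr
      have h3 : α * h ≤ 1 / 2 * h := by gcongr
      have h4 : l * (α * N + 2) ≤ 0.6931471808 * (α * N + 2) := by
        have : 0 ≤ α * N + 2 := by rw [hαN]; linarith
        gcongr
      rw [hαN] at h4 ⊢
      have h5 : (N - h) * α = 4 * h + 6 * Λ - α * h := by rw [← hαN]; ring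
      linarith
    refine (Real.exp_le_exp.2 h1).trans ?_
    rw [Real.exp_add, mul_comm]
    refine mul_le_mul_of_nonneg_right ?_ (Real.exp_pos _).le
    rw [Real.exp_neg, inv_le_comm₀ (Real.exp_pos _) (by norm_num)]
    have := Real.add_one_le_exp (2 / 5 : ℝ)
    norm_num at this ⊢
    linarith

/-- Chebyshev gives probability at most `α / 4` for exceeding `B`, so the expected count is at most
a quarter of `α N`. The Chernoff bound at parameter `1` then leaves room for the `h` outliers and
for rounding. -/
lemma measure_many_le (hW : ∀ i, Measurable (W i))
    (hind : iIndepFun W μ) (hlaw : ∀ i, μ.map (W i) = P)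
    (hFm : Measurable F) (hF : MemLp F 2 P) (hvar : ∫ z, F z ^ 2 ∂P ≤ σ ^ 2) (hh : 0 ≤ h)
    (hΛ : 23 / 10 ≤ Λ) (hα0 : 0 < α)
    (hαN : α * N = 4 * h + 6 * Λ) {B : ℝ} (hB0 : 0 < B) (hB : B ^ 2 * α = 4 * σ ^ 2)
    {I : Finset ι} (hI : I.card ≤ N) :
    μ.real {w | α * N - h - 2 < ∑ i ∈ I, (if B < F (W i w) then (1 : ℝ) else 0)}
      ≤ 1 / 4 * Real.exp (-Λ) := by
  set l := Real.exp 1 - 1 with hl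
  have hl2 : l ≤ 1.72 := by have := Real.exp_one_lt_d9; rw [hl]; linarith
  have hl0 : 0 ≤ l := by have := Real.exp_one_gt_d9; rw [hl]; linarith
  have hAm : MeasurableSet {z | B < F z} := measurableSet_lt measurable_const hFm
  have hp : P.real {z | B < F z} ≤ α / 4 := by
    have h1 : P.real {z | B < F z} * B ^ 2 ≤ ∫ z, F z ^ 2 ∂P := by
      rw [← smul_eq_mul, ← integral_indicator_const _ hAm]
      refine integral_mono ((integrable_const _).indicator hAm) hF.integrable_sq fun z => ?_
      by_cases hz : B < F z
      · rw [Set.indicator_of_mem (show z ∈ {z | B < F z} from hz)]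
        have : B ≤ F z := hz.le
        simp only
        gcongr
      · rw [Set.indicator_of_notMem (show z ∉ {z | B < F z} from hz)]
        positivity
    have h2 : 0 < B ^ 2 := by positivity
    refine le_of_mul_le_mul_right ?_ h2
    linarith
  have hint : ∫ z, Real.exp (if B < F z then 1 else 0) ∂P ≤ Real.exp (l * (α / 4)) := by
    have e : ∀ z, Real.exp (if B < F z then 1 else 0)
        = 1 + l * ({z | B < F z} : Set 𝒵).indicator (fun _ => (1 : ℝ)) z := by
      intro z
      by_cases hz : B < F z
      · rw [if_pos hz, Set.indicator_of_mem (show z ∈ {z | B < F z} from hz), hl]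
        ring
      · rw [if_neg hz, Set.indicator_of_notMem (show z ∉ {z | B < F z} from hz)]
        simp
    simp only [e]
    rw [integral_add (integrable_const _)
      (((integrable_const (1 : ℝ)).indicator hAm).const_mul _), integral_const_mul,
      integral_indicator_const _ hAm, integral_const, probReal_univ, one_smul, smul_eq_mul,
      mul_one, add_comm]
    refine le_trans ?_ (Real.add_one_le_exp _)
    gcongr
  have hch := chernoff_sum hW hind hlaw (G := fun z => if B < F z then 1 else 0)
    (Measurable.ite hAm measurable_const measurable_const) (C := 1)
    (fun z => by split_ifs <;> linarith) hint I (α * N - h - 2)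
  refine (measureReal_mono fun w hw => ?_).trans (hch.trans ?_)
  · have hw' : α * N - h - 2 < ∑ i ∈ I, (if B < F (W i w) then (1 : ℝ) else 0) := hw
    exact hw'.le
  · have h1 : (I.card : ℝ) * (l * (α / 4)) - (α * N - h - 2) ≤ -Λ + -3 := by
      have h2 : (I.card : ℝ) * (l * (α / 4)) ≤ N * (1.72 * (α / 4)) := by
        have : 0 ≤ N := (Nat.cast_nonneg _).trans hI
        gcongr
      have h3 : N * (1.72 * (α / 4)) = 0.43 * (α * N) := by ring
      rw [h3] at h2
      rw [hαN] at h2 ⊢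
      linarith
    refine (Real.exp_le_exp.2 h1).trans ?_
    rw [Real.exp_add, mul_comm]
    refine mul_le_mul_of_nonneg_right ?_ (Real.exp_pos _).le
    rw [Real.exp_neg, inv_le_comm₀ (Real.exp_pos _) (by norm_num)]
    have := Real.add_one_le_exp (3 : ℝ)
    norm_num at this ⊢
    linarith

/-- With `lam = √α / (2 σ)`, the largest value allowed by `lam * B ≤ 1`, the exponent is at most `N
α / 4 - (5/6) N α / 2 = -N α / 6`, and `6 Λ ≤ α N`. -/
lemma measure_sum_clip_le (hW : ∀ i, Measurable (W i))
    (hind : iIndepFun W μ) (hlaw : ∀ i, μ.map (W i) = P)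
    (hFm : Measurable F) (hF : MemLp F 2 P) (h0 : ∫ z, F z ∂P = 0) (hσ : 0 < σ)
    (hvar : ∫ z, F z ^ 2 ∂P ≤ σ ^ 2) (hα0 : 0 < α) (hΛN : 6 * Λ ≤ α * N)
    {b c : ℝ} (hc : 0 ≤ c) (hb : shortfall P F b = c) {I : Finset ι} (hI : I.card ≤ N) :
    μ.real {w | N * (c + 5 / 6 * (Real.sqrt α * σ))
        < ∑ i ∈ I, min (max b (F (W i w))) (2 * σ / Real.sqrt α)}
      ≤ Real.exp (-Λ) := by
  set r := Real.sqrt α with hr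
  have hr0 : 0 < r := Real.sqrt_pos.2 hα0
  have hr2 : r ^ 2 = α := Real.sq_sqrt hα0.le
  set B := 2 * σ / r with hB
  have hB0 : 0 < B := by positivity
  set lam := r / (2 * σ) with hlam
  have hlam0 : 0 < lam := by positivity
  have hlamB : lam * B = 1 := by rw [hlam, hB]; field_simp
  have hlams : lam ^ 2 * σ ^ 2 = α / 4 := by rw [hlam, ← hr2]; field_simp; norm_num
  have hint := integral_exp_clip_le (b := b) hFm hF h0 hvar hB0.le hlam0.le hlamB.le
  rw [hb, hlams] at hint
  have hch := chernoff_sum hW hind hlaw (G := fun z => lam * min (max b (F z)) B)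
    (((measurable_const.max hFm).min measurable_const).const_mul _) (C := 1)
    (fun z => (mul_le_mul_of_nonneg_left (min_le_right _ _) hlam0.le).trans hlamB.le) hint I
    (lam * (N * (c + 5 / 6 * (r * σ))))
  refine (measureReal_mono fun w hw => ?_).trans (hch.trans (Real.exp_le_exp.2 ?_))
  · change lam * (N * (c + 5 / 6 * (r * σ))) ≤ ∑ i ∈ I, lam * min (max b (F (W i w))) B
    rw [← Finset.mul_sum]
    exact mul_le_mul_of_nonneg_left (le_of_lt hw) hlam0.le
  · have h1 : lam * (r * σ) = α / 2 := by rw [hlam, ← hr2]; field_simp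
    have h2 : (I.card : ℝ) * (lam * c + α / 4) ≤ N * (lam * c + α / 4) := by gcongr
    have h3 : lam * (N * (c + 5 / 6 * (r * σ))) = N * (lam * c) + 5 / 6 * (N * (lam * (r * σ))) := by
      ring
    rw [h3, h1]
    linarith

/-- The probability that the samples do not behave well above their mean. -/
lemma measure_not_sideGood_le (hW : ∀ i, Measurable (W i))
    (hind : iIndepFun W μ) (hlaw : ∀ i, μ.map (W i) = P)
    (hFm : Measurable F) (hF : MemLp F 2 P) (h0 : ∫ z, F z ∂P = 0) (hσ : 0 < σ)
    (hvar : ∫ z, F z ^ 2 ∂P ≤ σ ^ 2) (hh : 0 ≤ h) (hΛ : 23 / 10 ≤ Λ) (hα0 : 0 < α)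
    (hα1 : α ≤ 1 / 2) (hαN : α * N = 4 * h + 6 * Λ) {I₁ I₂ : Finset ι} (h1 : N - h ≤ I₁.card)
    (h1' : I₁.card ≤ N) (h2 : I₂.card ≤ N) :
    μ.real {w | ¬ SideGood I₁ I₂ (shortfallLevel P F (3 * (Real.sqrt α * σ)))
        (2 * σ / Real.sqrt α) (α * N + 2) (α * N - h - 2)
        (N * (3 * (Real.sqrt α * σ) + 5 / 6 * (Real.sqrt α * σ))) fun i => F (W i w)}
      ≤ 2 * Real.exp (-Λ) := by
  set r := Real.sqrt α with hr
  have hr0 : 0 < r := Real.sqrt_pos.2 hα0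
  have hr2 : r ^ 2 = α := Real.sq_sqrt hα0.le
  have hc : 0 < 3 * (r * σ) := by positivity
  set b := shortfallLevel P F (3 * (r * σ))
  have hb : shortfall P F b = 3 * (r * σ) := shortfall_shortfallLevel hF h0 hc
  have hq := sq_div_le_measure_le hFm hF h0 hσ hvar hc hb
  -- The factor `3` in the shortfall makes `F ≤ b` have probability at least `9 α / (1 + 9 α)`,
  -- comfortably more than `α`.
  have e : (3 * (r * σ)) ^ 2 / ((3 * (r * σ)) ^ 2 + σ ^ 2) = 9 * α / (1 + 9 * α) := by
    rw [← hr2]; field_simp; ring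
  rw [e] at hq
  have m1 := measure_few_le hW hind hlaw hFm hh hΛ hα0.le hα1 hαN hq h1
  have m2 := measure_many_le hW hind hlaw hFm hF hvar hh hΛ hα0 hαN
    (B := 2 * σ / r) (by positivity) (by rw [← hr2]; field_simp; norm_num) h1'
  have m3 := measure_sum_clip_le hW hind hlaw hFm hF h0 hσ hvar hα0
    (Λ := Λ) (N := N) (by linarith) hc.le hb h2
  rw [← hr] at m3
  refine (measureReal_mono (fun w hw => ?_)).trans
    ((measureReal_union_le _ _).trans (add_le_add
      ((measureReal_union_le _ _).trans (add_le_add m1 m2)) m3) |>.trans (by linarith))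
  by_contra hn
  simp only [Set.mem_union, not_or, Set.mem_ofPred_eq, not_lt] at hn
  exact hw ⟨hn.1.1, hn.1.2, hn.2⟩

end SideGood

/-! ### Order statistics and the trimmed mean -/

lemma orderStat_le {ι : Type} {s : Finset ι} {x : ι → ℝ} {k : ℕ} {v : ℝ} (hk : 1 ≤ k)
    (hv : k ≤ (s.filter fun i => x i ≤ v).card) : orderStat s x k ≤ v := by
  -- Any level in the set is at least one of the samples, as `k ≥ 1`; for `k = 0` the set would be
  -- the whole line and its infimum the default `0`.
  refine csInf_le ⟨-∑ i ∈ s, |x i|, fun u hu => ?_⟩ hv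
  have hu' : k ≤ (s.filter fun i => x i ≤ u).card := hu
  obtain ⟨i, hi⟩ := Finset.card_pos.1 (lt_of_lt_of_le hk hu')
  rw [Finset.mem_filter] at hi
  have h1 := Finset.single_le_sum (f := fun i => |x i|) (fun _ _ => abs_nonneg _) hi.1
  have h2 := neg_abs_le (x i)
  linarith [hi.2]

lemma le_orderStat {ι : Type} {s : Finset ι} {x : ι → ℝ} {k : ℕ} {v : ℝ} (hk : k ≤ s.card)
    (hv : (s.filter fun i => x i < v).card < k) : v ≤ orderStat s x k := by
  -- `k ≤ #s` ensures that the set of levels is nonempty.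
  refine le_csInf ⟨∑ i ∈ s, |x i|, ?_⟩ fun u hu => ?_
  · change k ≤ (s.filter fun i => x i ≤ ∑ i ∈ s, |x i|).card
    rwa [Finset.filter_true_of_mem]
    intro i hi
    exact (le_abs_self _).trans
      (Finset.single_le_sum (f := fun i => |x i|) (fun _ _ => abs_nonneg _) hi)
  · have hu' : k ≤ (s.filter fun i => x i ≤ u).card := hu
    by_contra! hlt
    refine absurd (hu'.trans (Finset.card_le_card ?_)) (not_le.2 hv)
    exact Finset.monotone_filter_right s fun i _ hi => lt_of_le_of_lt hi hlt

/-- The indices in the first half that belong to `G`. -/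
def firstHalf {m : ℕ} (G : Finset (Fin m)) : Finset (Fin m) := G.filter fun i => (i : ℕ) < m / 2

/-- The indices in the second half that belong to `G`. -/
def secondHalf {m : ℕ} (G : Finset (Fin m)) : Finset (Fin m) := G.filter fun i => m / 2 ≤ (i : ℕ)

lemma card_filter_lt_half (m : ℕ) :
    (Finset.univ.filter fun i : Fin m => (i : ℕ) < m / 2).card = m / 2 := by
  rw [Fin.card_filter_val_lt, min_eq_right (Nat.div_le_self m 2)]

lemma card_filter_half_le {m : ℕ} (hm : Even m) :
    (Finset.univ.filter fun i : Fin m => m / 2 ≤ (i : ℕ)).card = m / 2 := by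
  have h := Finset.card_filter_add_card_filter_not (s := (Finset.univ : Finset (Fin m)))
    (fun i : Fin m => (i : ℕ) < m / 2)
  rw [card_filter_lt_half, Finset.card_univ, Fintype.card_fin] at h
  simp only [not_lt] at h
  obtain ⟨k, rfl⟩ := hm
  omega

lemma card_filter_le_add_card_compl {m : ℕ} (G : Finset (Fin m)) (p : Fin m → Prop)
    [DecidablePred p] (q : Fin m → Prop) [DecidablePred q] :
    ((Finset.univ.filter q).filter p).card ≤ ((G.filter q).filter p).card + Gᶜ.card := by
  refine (Finset.card_le_card (t := (G.filter q).filter p ∪ Gᶜ) ?_).trans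
    (Finset.card_union_le _ _)
  intro i hi
  simp only [Finset.mem_filter, Finset.mem_univ, true_and, Finset.mem_union,
    Finset.mem_compl] at hi ⊢
  tauto

section TrimmedMean

variable {m : ℕ} {x : Fin m → ℝ} {G : Finset (Fin m)} {α h Λ a b B S : ℝ}

lemma card_half_eq (hm : Even m) : ((m / 2 : ℕ) : ℝ) = (m : ℝ) / 2 := by
  obtain ⟨k, rfl⟩ := hm
  rw [show (k + k) / 2 = k by omega]
  push_cast
  ring

/-- Many inliers at most `a + b` force the lower quantile down. At most `α N - 2` of all first-half
samples exceed `a + B`, even if every outlier does, which controls the upper quantile. -/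
lemma halfQuantile_upper (hm : Even m) (hα1 : α ≤ 1 / 2)
    (hαN : 23 / 10 ≤ α * (m / 2)) (hG : (Gᶜ.card : ℝ) ≤ h)
    (hgood : SideGood (firstHalf G) (secondHalf G) b B (α * (m / 2) + 2) (α * (m / 2) - h - 2) S
      fun i => x i - a) :
    halfQuantile x α ≤ a + b ∧ halfQuantile x (1 - α) ≤ a + B := by
  have hm2 := card_half_eq hm
  have hN : 0 ≤ (m : ℝ) / 2 := by positivity
  have hmul : α * (m / 2) ≤ 1 / 2 * (m / 2) := by gcongr
  constructor
  · refine orderStat_le ?_ ?_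
    · rw [Nat.one_le_floor_iff]
      linarith [mul_div_assoc α (m : ℝ) 2]
    · have h1 := hgood.many_le
      rw [Finset.sum_boole] at h1
      have h2 : ((firstHalf G).filter fun i => x i - a ≤ b).card
          ≤ ((Finset.univ.filter fun i : Fin m => (i : ℕ) < m / 2).filter
            fun i => x i ≤ a + b).card := by
        refine Finset.card_le_card fun i hi => ?_
        simp only [firstHalf, Finset.mem_filter, Finset.mem_univ, true_and] at hi ⊢
        exact ⟨hi.1.2, by linarith [hi.2]⟩
      refine le_trans (Nat.cast_le (α := ℝ).1 ?_) h2
      refine (Nat.floor_le (by rw [mul_div_assoc]; linarith)).trans ?_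
      rw [mul_div_assoc]
      linarith
  · refine orderStat_le ?_ ?_
    · rw [Nat.one_le_floor_iff, mul_div_assoc]
      linarith
    · have h1 := hgood.few_gt
      rw [Finset.sum_boole] at h1
      set H := Finset.univ.filter fun i : Fin m => (i : ℕ) < m / 2 with hH
      have h2 := card_filter_le_add_card_compl G (fun i => B < x i - a)
        (fun i : Fin m => (i : ℕ) < m / 2)
      have h3 := Finset.card_filter_add_card_filter_not (s := H) (fun i => x i ≤ a + B)
      rw [hH, card_filter_lt_half, ← hH] at h3
      have h4 : (H.filter fun i => ¬ x i ≤ a + B) = H.filter fun i => B < x i - a := by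
        refine Finset.filter_congr fun i _ => ?_
        rw [not_le]
        constructor <;> intro h <;> linarith
      rw [h4] at h3
      refine Nat.cast_le (α := ℝ).1 ?_
      refine (Nat.floor_le (by rw [mul_div_assoc]; nlinarith)).trans ?_
      have h2' : ((H.filter fun i => B < x i - a).card : ℝ)
          ≤ ((firstHalf G).filter fun i => B < x i - a).card + (Gᶜ.card : ℝ) := by exact_mod_cast h2
      have h3' : ((H.filter fun i => x i ≤ a + B).card : ℝ)
          + (H.filter fun i => B < x i - a).card = (m : ℝ) / 2 := by
        rw [← hm2]; exact_mod_cast h3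
      rw [mul_div_assoc]
      linarith

/-- The reflection of `halfQuantile_upper`, with the roles of the two quantiles exchanged. Here
strict counts must stay below a rounded-down rank, which uses the slack `2` in the counts. -/
lemma halfQuantile_lower (hm : Even m) (hα1 : α ≤ 1 / 2)
    (hαN : 23 / 10 ≤ α * (m / 2)) (hG : (Gᶜ.card : ℝ) ≤ h)
    (hgood : SideGood (firstHalf G) (secondHalf G) b B (α * (m / 2) + 2) (α * (m / 2) - h - 2) S
      fun i => a - x i) :
    a - B ≤ halfQuantile x α ∧ a - b ≤ halfQuantile x (1 - α) := by
  have hm2 := card_half_eq hm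
  have hN : 0 ≤ (m : ℝ) / 2 := by positivity
  have hmul : α * (m / 2) ≤ 1 / 2 * (m / 2) := by gcongr
  set H := Finset.univ.filter fun i : Fin m => (i : ℕ) < m / 2 with hH
  have hHcard : H.card = m / 2 := card_filter_lt_half m
  constructor
  · refine le_orderStat ?_ ?_
    · rw [← hH, hHcard]
      refine Nat.cast_le (α := ℝ).1 ?_
      refine (Nat.floor_le (by rw [mul_div_assoc]; linarith)).trans ?_
      rw [mul_div_assoc, hm2]
      linarith
    · have h1 := hgood.few_gt
      rw [Finset.sum_boole] at h1
      have h2 := card_filter_le_add_card_compl G (fun i => B < a - x i)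
        (fun i : Fin m => (i : ℕ) < m / 2)
      have h4 : (H.filter fun i => x i < a - B) = H.filter fun i => B < a - x i := by
        refine Finset.filter_congr fun i _ => ?_
        constructor <;> intro h <;> linarith
      rw [← hH, h4]
      refine Nat.cast_lt (α := ℝ).1 ?_
      have h2' : ((H.filter fun i => B < a - x i).card : ℝ)
          ≤ ((firstHalf G).filter fun i => B < a - x i).card + (Gᶜ.card : ℝ) := by exact_mod_cast h2
      have := Nat.lt_floor_add_one (α * m / 2)
      rw [mul_div_assoc] at this ⊢
      linarith
  · refine le_orderStat ?_ ?_
    · rw [← hH, hHcard]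
      refine Nat.cast_le (α := ℝ).1 ?_
      refine (Nat.floor_le (by rw [mul_div_assoc]; nlinarith)).trans ?_
      rw [mul_div_assoc, hm2]
      linarith
    · have h1 := hgood.many_le
      rw [Finset.sum_boole] at h1
      have h2 : ((firstHalf G).filter fun i => a - x i ≤ b).card
          ≤ (H.filter fun i => ¬ x i < a - b).card := by
        refine Finset.card_le_card fun i hi => ?_
        simp only [hH, firstHalf, Finset.mem_filter, Finset.mem_univ, true_and, not_lt] at hi ⊢
        exact ⟨hi.1.2, by linarith [hi.2]⟩
      have h3 := Finset.card_filter_add_card_filter_not (s := H) (fun i => x i < a - b)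
      rw [hHcard] at h3
      rw [← hH]
      refine Nat.cast_lt (α := ℝ).1 ?_
      have h2' : (((firstHalf G).filter fun i => a - x i ≤ b).card : ℝ)
          ≤ (H.filter fun i => ¬ x i < a - b).card := by exact_mod_cast h2
      have h3' : ((H.filter fun i => x i < a - b).card : ℝ)
          + (H.filter fun i => ¬ x i < a - b).card = (m : ℝ) / 2 := by
        rw [← hm2]; exact_mod_cast h3
      have := Nat.lt_floor_add_one ((1 - α) * m / 2)
      rw [mul_div_assoc] at this ⊢
      linarith

lemma sum_second_half_le (hB : 0 ≤ B) (hG : (Gᶜ.card : ℝ) ≤ h) {φ : Fin m → ℝ}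
    (hφB : ∀ i, φ i ≤ B) (hφ : ∑ i ∈ secondHalf G, φ i ≤ S) :
    ∑ i ∈ Finset.univ.filter (fun i : Fin m => m / 2 ≤ (i : ℕ)), φ i ≤ S + h * B := by
  have hsub : secondHalf G ⊆ Finset.univ.filter fun i : Fin m => m / 2 ≤ (i : ℕ) :=
    Finset.filter_subset_filter _ (Finset.subset_univ G)
  rw [← Finset.sum_sdiff hsub, add_comm]
  refine add_le_add hφ ?_
  refine (Finset.sum_le_card_nsmul _ _ B fun i _ => hφB i).trans ?_
  rw [nsmul_eq_mul]
  refine mul_le_mul_of_nonneg_right (le_trans (Nat.cast_le.2 (Finset.card_le_card ?_)) hG) hB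
  intro i hi
  simp only [secondHalf, Finset.mem_sdiff, Finset.mem_filter, Finset.mem_univ, true_and,
    Finset.mem_compl] at hi ⊢
  tauto

/-- Clipping is monotone in its thresholds, so the empirical quantiles may be replaced by `a + b`
and `a + B`; outliers then contribute at most `B` each. -/
lemma trimmedMean_le (hm : Even m) (hm0 : 0 < m) (hα1 : α ≤ 1 / 2)
    (hαN : 23 / 10 ≤ α * (m / 2)) (hG : (Gᶜ.card : ℝ) ≤ h) (hB : 0 ≤ B)
    (hgood : SideGood (firstHalf G) (secondHalf G) b B (α * (m / 2) + 2) (α * (m / 2) - h - 2) S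
      fun i => x i - a) :
    trimmedMean α x ≤ a + 2 / m * (S + h * B) := by
  obtain ⟨h1, h2⟩ := halfQuantile_upper hm hα1 hαN hG hgood
  have hm' : (0 : ℝ) < m := by exact_mod_cast hm0
  have hs := sum_second_half_le hB hG (fun i => min_le_right (max b (x i - a)) B) hgood.sum_le
  have hle : ∑ i ∈ Finset.univ.filter (fun i : Fin m => m / 2 ≤ (i : ℕ)),
      min (max (halfQuantile x α) (x i)) (halfQuantile x (1 - α))
      ≤ ∑ i ∈ Finset.univ.filter (fun i : Fin m => m / 2 ≤ (i : ℕ)),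
        (a + min (max b (x i - a)) B) := by
    refine Finset.sum_le_sum fun i _ => ?_
    rw [← min_add_add_left, ← max_add_add_left]
    exact min_le_min (max_le_max h1 (by linarith)) h2
  rw [Finset.sum_add_distrib, Finset.sum_const, card_filter_half_le hm, nsmul_eq_mul,
    card_half_eq hm] at hle
  calc trimmedMean α x ≤ 2 / m * (m / 2 * a + (S + h * B)) := by
        rw [trimmedMean]
        refine mul_le_mul_of_nonneg_left ?_ (by positivity)
        linarith
    _ = _ := by field_simp

/-- Reflection exchanges the order of the two clipping operations. They commute when `b ≤ B`, which
is why that condition appears here and not in `trimmedMean_le`. -/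
lemma le_trimmedMean (hm : Even m) (hm0 : 0 < m) (hα1 : α ≤ 1 / 2)
    (hαN : 23 / 10 ≤ α * (m / 2)) (hG : (Gᶜ.card : ℝ) ≤ h) (hB : 0 ≤ B) (hbB : b ≤ B)
    (hgood : SideGood (firstHalf G) (secondHalf G) b B (α * (m / 2) + 2) (α * (m / 2) - h - 2) S
      fun i => a - x i) :
    a - 2 / m * (S + h * B) ≤ trimmedMean α x := by
  obtain ⟨h1, h2⟩ := halfQuantile_lower hm hα1 hαN hG hgood
  have hm' : (0 : ℝ) < m := by exact_mod_cast hm0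
  have hs := sum_second_half_le hB hG (fun i => min_le_right (max b (a - x i)) B) hgood.sum_le
  have hle : ∑ i ∈ Finset.univ.filter (fun i : Fin m => m / 2 ≤ (i : ℕ)),
        (a - min (max b (a - x i)) B)
      ≤ ∑ i ∈ Finset.univ.filter (fun i : Fin m => m / 2 ≤ (i : ℕ)),
      min (max (halfQuantile x α) (x i)) (halfQuantile x (1 - α)) := by
    refine Finset.sum_le_sum fun i _ => ?_
    have e : a - min (max b (a - x i)) B ≤ min (max (a - B) (x i)) (a - b) := by
      refine le_min ?_ ?_
      · rcases le_total (max b (a - x i)) B with h | h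
        · rw [min_eq_left h]
          exact le_max_of_le_right (by linarith [le_max_right b (a - x i)])
        · rw [min_eq_right h]
          exact le_max_left _ _
      · have : b ≤ min (max b (a - x i)) B := le_min (le_max_left _ _) hbB
        linarith
    exact e.trans (min_le_min (max_le_max h1 le_rfl) h2)
  rw [Finset.sum_sub_distrib, Finset.sum_const, card_filter_half_le hm, nsmul_eq_mul,
    card_half_eq hm] at hle
  calc a - 2 / m * (S + h * B) = 2 / m * (m / 2 * a - (S + h * B)) := by field_simp
    _ ≤ trimmedMean α x := by
        rw [trimmedMean]
        refine mul_le_mul_of_nonneg_left ?_ (by positivity)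
        linarith

end TrimmedMean

/-! ### Accuracy of the gradient estimator at a random point -/

/-- The signed centred `j`-th coordinate of the sample gradient. -/
noncomputable def centredCoord {d : ℕ} (labels : Set ℝ) (loss : ℝ → ℝ → ℝ)
    (P : Measure (E d × ℝ)) (ς : ℝ) (j : Fin d) (θ : E d) (z : E d × ℝ) : ℝ :=
  ς * (gradCoord labels loss j θ z - meanGrad labels loss P θ j)

section Centred

variable {d : ℕ} {labels : Set ℝ} {loss : ℝ → ℝ → ℝ} {P : Measure (E d × ℝ)}

lemma measurable_meanGrad (h_labels : MeasurableSet labels) (h_loss : IsAdmissibleLoss labels loss)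
    (hP : IsAdmissibleLaw labels P) (j : Fin d) :
    Measurable fun θ => meanGrad labels loss P θ j := by
  have := hP.prob
  exact (measurable_gradCoord h_labels h_loss j).stronglyMeasurable.integral_prod_right'.measurable

lemma measurable_centredCoord (h_labels : MeasurableSet labels)
    (h_loss : IsAdmissibleLoss labels loss) (hP : IsAdmissibleLaw labels P) (ς : ℝ) (j : Fin d) :
    Measurable fun q : E d × (E d × ℝ) => centredCoord labels loss P ς j q.1 q.2 :=
  ((measurable_gradCoord h_labels h_loss j).sub
    ((measurable_meanGrad h_labels h_loss hP j).comp measurable_fst)).const_mul ς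

lemma measurable_centredCoord_right (h_labels : MeasurableSet labels)
    (h_loss : IsAdmissibleLoss labels loss) (ς : ℝ) (j : Fin d) (θ : E d) :
    Measurable fun z => centredCoord labels loss P ς j θ z :=
  ((measurable_gradCoord_right h_labels h_loss j θ).sub_const _).const_mul ς

lemma memLp_centredCoord (h_labels : MeasurableSet labels) (h_loss : IsAdmissibleLoss labels loss)
    (hP : IsAdmissibleLaw labels P) (ς : ℝ) (j : Fin d) (θ : E d) :
    MemLp (centredCoord labels loss P ς j θ) 2 P := by
  have := hP.prob
  exact ((memLp_gradCoord h_labels h_loss hP j θ).sub (memLp_const _)).const_mul ς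

lemma integral_centredCoord (h_labels : MeasurableSet labels)
    (h_loss : IsAdmissibleLoss labels loss) (hP : IsAdmissibleLaw labels P) (ς : ℝ) (j : Fin d)
    (θ : E d) : ∫ z, centredCoord labels loss P ς j θ z ∂P = 0 := by
  have := hP.prob
  simp only [centredCoord]
  rw [integral_const_mul, integral_sub (integrable_gradCoord h_labels h_loss hP j θ)
    (integrable_const _), integral_const, probReal_univ, one_smul]
  simp [meanGrad]

lemma integral_sq_centredCoord_le (h_labels : MeasurableSet labels)
    (h_loss : IsAdmissibleLoss labels loss) (hP : IsAdmissibleLaw labels P) {ς : ℝ}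
    (hς : ς ^ 2 = 1) {Θ : Set (E d)} (hΘ : IsCompact Θ) {θ : E d} (hθ : θ ∈ Θ) (j : Fin d) :
    ∫ z, centredCoord labels loss P ς j θ z ^ 2 ∂P ≤ sigmaMax P loss Θ ^ 2 := by
  simp only [centredCoord, mul_pow, hς, one_mul]
  exact integral_sq_gradCoord_sub_le h_labels h_loss hP hΘ hθ j

/-- Needed because the point at which the level is taken is random; Fubini requires the good event
to be jointly measurable in point and data. -/
lemma measurable_shortfallLevel (h_labels : MeasurableSet labels)
    (h_loss : IsAdmissibleLoss labels loss) (hP : IsAdmissibleLaw labels P) (ς : ℝ) (j : Fin d)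
    {c : ℝ} (hc : 0 < c) :
    Measurable fun θ => shortfallLevel P (centredCoord labels loss P ς j θ) c := by
  have := hP.prob
  refine measurable_of_Iic fun x => ?_
  have e : (fun θ => shortfallLevel P (centredCoord labels loss P ς j θ) c) ⁻¹' Set.Iic x
      = {θ | c ≤ shortfall P (centredCoord labels loss P ς j θ) x} := by
    ext θ
    exact shortfallLevel_le_iff (memLp_centredCoord h_labels h_loss hP ς j θ)
      (integral_centredCoord h_labels h_loss hP ς j θ) hc
  rw [e]
  refine measurableSet_le measurable_const ?_
  have hm : Measurable fun q : E d × (E d × ℝ) =>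
      max (x - centredCoord labels loss P ς j q.1 q.2) 0 :=
    (measurable_const.sub (measurable_centredCoord h_labels h_loss hP ς j)).max measurable_const
  exact hm.stronglyMeasurable.integral_prod_right'.measurable

lemma measurableSet_sideGood {ι : Type*} [Countable ι] (h_labels : MeasurableSet labels)
    (h_loss : IsAdmissibleLoss labels loss) (hP : IsAdmissibleLaw labels P) (ς : ℝ) (j : Fin d)
    {c : ℝ} (hc : 0 < c) (I₁ I₂ : Finset ι) (B s₁ s₂ S : ℝ) :
    MeasurableSet {q : E d × (ι → E d × ℝ) | SideGood I₁ I₂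
      (shortfallLevel P (centredCoord labels loss P ς j q.1) c) B s₁ s₂ S
      fun i => centredCoord labels loss P ς j q.1 (q.2 i)} := by
  have hb : Measurable fun q : E d × (ι → E d × ℝ) =>
      shortfallLevel P (centredCoord labels loss P ς j q.1) c :=
    Measurable.comp (g := fun θ => shortfallLevel P (centredCoord labels loss P ς j θ) c)
      (measurable_shortfallLevel h_labels h_loss hP ς j hc) measurable_fst
  have hy : ∀ i, Measurable fun q : E d × (ι → E d × ℝ) =>
      centredCoord labels loss P ς j q.1 (q.2 i) := fun i =>
    Measurable.comp (g := fun q : E d × (E d × ℝ) => centredCoord labels loss P ς j q.1 q.2)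
      (f := fun q : E d × (ι → E d × ℝ) => (q.1, q.2 i))
      (measurable_centredCoord h_labels h_loss hP ς j)
      (measurable_fst.prodMk ((measurable_pi_apply i).comp measurable_snd))
  have h1 : MeasurableSet {q : E d × (ι → E d × ℝ) | s₁ ≤ ∑ i ∈ I₁,
      if centredCoord labels loss P ς j q.1 (q.2 i)
        ≤ shortfallLevel P (centredCoord labels loss P ς j q.1) c then (1 : ℝ) else 0} :=
    measurableSet_le measurable_const (Finset.measurable_fun_sum I₁ fun i _ =>
      Measurable.ite (measurableSet_le (hy i) hb) measurable_const measurable_const)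
  have h2 : MeasurableSet {q : E d × (ι → E d × ℝ) | ∑ i ∈ I₁,
      (if B < centredCoord labels loss P ς j q.1 (q.2 i) then (1 : ℝ) else 0) ≤ s₂} :=
    measurableSet_le (Finset.measurable_fun_sum I₁ fun i _ =>
      Measurable.ite (measurableSet_lt measurable_const (hy i)) measurable_const measurable_const)
      measurable_const
  have h3 : MeasurableSet {q : E d × (ι → E d × ℝ) | ∑ i ∈ I₂,
      min (max (shortfallLevel P (centredCoord labels loss P ς j q.1) c)
        (centredCoord labels loss P ς j q.1 (q.2 i))) B ≤ S} :=
    measurableSet_le (Finset.measurable_fun_sum I₂ fun i _ => (hb.max (hy i)).min measurable_const)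
      measurable_const
  convert (h1.inter h2).inter h3 using 1
  ext q
  exact ⟨fun h => ⟨⟨h.1, h.2⟩, h.3⟩, fun h => ⟨h.1.1, h.1.2, h.2⟩⟩

end Centred

/-- A bound on the sections of an event passes to independent random points. -/
lemma measureReal_le_of_section_le {Ω 𝒳 𝒰 : Type*} [MeasurableSpace Ω] [MeasurableSpace 𝒳]
    [MeasurableSpace 𝒰] {μ : Measure Ω} [IsProbabilityMeasure μ] {X : Ω → 𝒳} {U : Ω → 𝒰}
    (hX : Measurable X) (hU : Measurable U) (hind : IndepFun X U μ) {S : Set (𝒳 × 𝒰)}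
    (hS : MeasurableSet S) {c : ℝ} (hc : 0 ≤ c)
    (h : ∀ w, μ.real {w' | (X w, U w') ∈ S} ≤ c) :
    μ.real {w | (X w, U w) ∈ S} ≤ c := by
  have hmap := (indepFun_iff_map_prod_eq_prod_map_map hX.aemeasurable hU.aemeasurable).1 hind
  -- By independence the joint law is a product, and Tonelli expresses the probability as an average
  -- over the first component.
  have h1 : μ {w | (X w, U w) ∈ S} = ∫⁻ w, μ {w' | (X w, U w') ∈ S} ∂μ := by
    have e : μ {w | (X w, U w) ∈ S} = (μ.map fun w => (X w, U w)) S := by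
      rw [Measure.map_apply (hX.prodMk hU) hS]; rfl
    rw [e, hmap, Measure.prod_apply hS,
      lintegral_map (measurable_measure_prodMk_left hS) hX]
    refine lintegral_congr fun w => ?_
    rw [Measure.map_apply hU (measurable_prodMk_left hS)]
    rfl
  have h2 : μ {w | (X w, U w) ∈ S} ≤ ENNReal.ofReal c := by
    rw [h1]
    calc ∫⁻ w, μ {w' | (X w, U w') ∈ S} ∂μ ≤ ∫⁻ _, ENNReal.ofReal c ∂μ := by
          refine lintegral_mono fun w => ?_
          rw [← ENNReal.ofReal_toReal (measure_ne_top μ _)]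
          exact ENNReal.ofReal_le_ofReal (h w)
      _ = ENNReal.ofReal c := by simp
  exact ENNReal.toReal_le_of_le_ofReal hc h2

/-- Independence is a statement about the family of inliers alone, indexed by a subtype; the trimmed
mean works with the indices of the whole batch. -/
lemma SideGood.of_subtype {ι : Type*} {p : ι → Prop} [DecidablePred p] {I₁ I₂ : Finset ι}
    (h₁ : ∀ i ∈ I₁, p i) (h₂ : ∀ i ∈ I₂, p i) {b B s₁ s₂ S : ℝ} {y y' : ι → ℝ}
    (hy : ∀ i, p i → y i = y' i)
    (h : SideGood (I₁.subtype p) (I₂.subtype p) b B s₁ s₂ S fun i => y i) :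
    SideGood I₁ I₂ b B s₁ s₂ S y' := by
  have e1 := Finset.sum_subtype_of_mem (fun i => if y i ≤ b then (1 : ℝ) else 0) h₁
  have e2 := Finset.sum_subtype_of_mem (fun i => if B < y i then (1 : ℝ) else 0) h₁
  have e3 := Finset.sum_subtype_of_mem (fun i => min (max b (y i)) B) h₂
  obtain ⟨a1, a2, a3⟩ := h
  rw [e1] at a1
  rw [e2] at a2
  rw [e3] at a3
  refine ⟨a1.trans_eq ?_, Eq.trans_le ?_ a2, Eq.trans_le ?_ a3⟩
  · exact Finset.sum_congr rfl fun i hi => by rw [hy i (h₁ i hi)]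
  · exact Finset.sum_congr rfl fun i hi => by rw [hy i (h₁ i hi)]
  · exact Finset.sum_congr rfl fun i hi => by rw [hy i (h₂ i hi)]

section Batch

variable {Ω : Type*} [MeasurableSpace Ω] {μ : Measure Ω} {d n m T : ℕ}
  {P : Measure (E d × ℝ)} {Z : Fin n → Ω → E d × ℝ} {O : Finset (Fin n)}
  {batch : ℕ → Fin m → Fin n} {η : ℝ}

lemma IsSplitCorruptedSample.indepFun_batch (h : IsSplitCorruptedSample μ P Z O T batch η) {t : ℕ}
    (ht : t < T) {X : Ω → E d} (hX : Measurable[pastSigma Z batch t] X) :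
    IndepFun X (fun w (i : {i : Fin m // batch t i ∉ O}) => Z (batch t i) w) μ := by
  rw [IndepFun_iff_Indep]
  refine indep_of_indep_of_le_left (indep_of_indep_of_le_right (h.fresh t ht).symm ?_)
    hX.comap_le
  refine Measurable.comap_le ?_
  refine @measurable_pi_lambda _ _ _ (inlierSigma Z batch O t) _ _ fun i => ?_
  rw [measurable_iff_comap_le]
  exact le_iSup₂_of_le i.1 i.2 le_rfl

lemma IsSplitCorruptedSample.pastSigma_le (h : IsSplitCorruptedSample μ P Z O T batch η) (t : ℕ) :
    pastSigma Z batch t ≤ ‹MeasurableSpace Ω› :=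
  iSup_le fun _ => iSup_le fun _ => iSup_le fun i => (h.measurable (batch _ i)).comap_le

lemma IsSplitCorruptedSample.iIndepFun_batch (h : IsSplitCorruptedSample μ P Z O T batch η) {t : ℕ}
    (ht : t < T) : iIndepFun (fun i : {i : Fin m // batch t i ∉ O} => Z (batch t i)) μ := by
  have hinj : Function.Injective
      fun i : {i : Fin m // batch t i ∉ O} => (⟨batch t i, i.2⟩ : {i : Fin n // i ∉ O}) := by
    intro i i' hii
    exact Subtype.ext (h.batch_disjoint t ht t ht i i' (congrArg Subtype.val hii)).2
  exact h.inlier_indep.precomp hinj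

variable {labels : Set ℝ} {loss : ℝ → ℝ → ℝ} {Θ : Set (E d)} {α Λ : ℝ}

lemma card_half_compl_bounds {G : Finset (Fin m)} {h : ℝ} (hm : Even m)
    (hG : (Gᶜ.card : ℝ) ≤ h) :
    (m : ℝ) / 2 - h ≤ (firstHalf G).card ∧ ((firstHalf G).card : ℝ) ≤ m / 2
      ∧ ((secondHalf G).card : ℝ) ≤ m / 2 := by
  rw [← card_half_eq hm]
  refine ⟨?_, Nat.cast_le.2 ?_, Nat.cast_le.2 ?_⟩
  · have h1 := card_filter_le_add_card_compl G (fun _ => True) (fun i : Fin m => (i : ℕ) < m / 2)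
    simp only [Finset.filter_true, card_filter_lt_half] at h1
    have h2 : ((m / 2 : ℕ) : ℝ) ≤ (firstHalf G).card + (Gᶜ.card : ℝ) := by exact_mod_cast h1
    linarith
  · exact (Finset.card_le_card (Finset.filter_subset_filter _ (Finset.subset_univ G))).trans_eq
      (card_filter_lt_half m)
  · exact (Finset.card_le_card (Finset.filter_subset_filter _ (Finset.subset_univ G))).trans_eq
      (card_filter_half_le hm)

/-- The indices of the inliers of a batch. -/
def inlierIndices (batch : ℕ → Fin m → Fin n) (O : Finset (Fin n)) (t : ℕ) : Finset (Fin m) :=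
  Finset.univ.filter fun i => batch t i ∉ O

lemma IsSplitCorruptedSample.card_compl_le (h : IsSplitCorruptedSample μ P Z O T batch η) {t : ℕ}
    (ht : t < T) : (((inlierIndices batch O t)ᶜ).card : ℝ) ≤ η * m := by
  refine le_trans (le_of_eq ?_) (h.corruption t ht)
  congr 2
  ext i
  simp [inlierIndices]

variable [IsProbabilityMeasure μ]

/-- With high probability, the inliers of a fresh batch behave well at a point that depends only
on the earlier batches. -/
lemma IsSplitCorruptedSample.measure_not_sideGood_le
    (h : IsSplitCorruptedSample μ P Z O T batch η) (h_labels : MeasurableSet labels)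
    (h_loss : IsAdmissibleLoss labels loss) (hP : IsAdmissibleLaw labels P) (hΘ : IsCompact Θ)
    (hσ : 0 < sigmaMax P loss Θ) (hm : Even m) (hη : 0 ≤ η) (hΛ : 23 / 10 ≤ Λ) (hα0 : 0 < α)
    (hα1 : α ≤ 1 / 2) (hαN : α * (m / 2) = 4 * (η * m) + 6 * Λ) {t : ℕ} (ht : t < T)
    {X : Ω → E d} (hX : Measurable[pastSigma Z batch t] X) (hXΘ : ∀ w, X w ∈ Θ) {ς : ℝ}
    (hς : ς ^ 2 = 1) (j : Fin d) :
    μ.real {w | ¬ SideGood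
        ((firstHalf (inlierIndices batch O t)).subtype fun i => batch t i ∉ O)
        ((secondHalf (inlierIndices batch O t)).subtype fun i => batch t i ∉ O)
        (shortfallLevel P (centredCoord labels loss P ς j (X w))
          (3 * (Real.sqrt α * sigmaMax P loss Θ)))
        (2 * sigmaMax P loss Θ / Real.sqrt α) (α * (m / 2) + 2) (α * (m / 2) - η * m - 2)
        (m / 2 * (3 * (Real.sqrt α * sigmaMax P loss Θ)
          + 5 / 6 * (Real.sqrt α * sigmaMax P loss Θ)))
        fun i => centredCoord labels loss P ς j (X w) (Z (batch t i) w)}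
      ≤ 2 * Real.exp (-Λ) := by
  have := hP.prob
  have hr0 : 0 < Real.sqrt α := Real.sqrt_pos.2 hα0
  have hc : 0 < 3 * (Real.sqrt α * sigmaMax P loss Θ) := by positivity
  obtain ⟨c1, c2, c3⟩ := card_half_compl_bounds hm (h.card_compl_le ht)
  have hp : ∀ i ∈ inlierIndices batch O t, batch t i ∉ O := fun i hi => (Finset.mem_filter.1 hi).2
  have hpf : ∀ i ∈ firstHalf (inlierIndices batch O t), batch t i ∉ O :=
    fun i hi => hp i (Finset.mem_filter.1 hi).1
  have hps : ∀ i ∈ secondHalf (inlierIndices batch O t), batch t i ∉ O :=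
    fun i hi => hp i (Finset.mem_filter.1 hi).1
  have k1 : ((firstHalf (inlierIndices batch O t)).subtype fun i => batch t i ∉ O).card
      = (firstHalf (inlierIndices batch O t)).card := by
    rw [Finset.card_subtype, Finset.filter_eq_self.2 hpf]
  have k2 : ((secondHalf (inlierIndices batch O t)).subtype fun i => batch t i ∉ O).card
      = (secondHalf (inlierIndices batch O t)).card := by
    rw [Finset.card_subtype, Finset.filter_eq_self.2 hps]
  have hS := (measurableSet_sideGood h_labels h_loss hP ς j hc
    ((firstHalf (inlierIndices batch O t)).subtype fun i => batch t i ∉ O)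
    ((secondHalf (inlierIndices batch O t)).subtype fun i => batch t i ∉ O)
    (2 * sigmaMax P loss Θ / Real.sqrt α) (α * (m / 2) + 2) (α * (m / 2) - η * m - 2)
    (m / 2 * (3 * (Real.sqrt α * sigmaMax P loss Θ)
          + 5 / 6 * (Real.sqrt α * sigmaMax P loss Θ)))).compl
  refine measureReal_le_of_section_le (hX.mono (h.pastSigma_le t) le_rfl)
    (measurable_pi_lambda _ fun i => h.measurable _) (h.indepFun_batch ht hX) hS (by positivity)
    fun w => ?_
  exact SparseMD.measure_not_sideGood_le (fun i => h.measurable _) (h.iIndepFun_batch ht)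
    (fun i => h.inlier_law _ i.2) (measurable_centredCoord_right h_labels h_loss ς j (X w))
    (memLp_centredCoord h_labels h_loss hP ς j (X w))
    (integral_centredCoord h_labels h_loss hP ς j (X w)) hσ
    (integral_sq_centredCoord_le h_labels h_loss hP hς hΘ (hXΘ w) j) (by positivity) hΛ hα0 hα1
    hαN (by rw [k1]; exact c1) (by rw [k1]; exact c2) (by rw [k2]; exact c3)

/-- Amounts to `13/3 ≤ 7 / √2`. -/
lemma sqrt_error_le {σ ε : ℝ} (hσ : 0 < σ) (hα0 : 0 < α) (hε : ε = 7 * σ * Real.sqrt (α / 2)) :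
    13 / 3 * (Real.sqrt α * σ) ≤ ε := by
  rw [hε]
  have h1 : 13 / 3 * Real.sqrt α ≤ 7 * Real.sqrt (α / 2) := by
    refine abs_le_of_sq_le_sq' ?_ (by positivity) |>.2
    rw [mul_pow, mul_pow, Real.sq_sqrt hα0.le, Real.sq_sqrt (by positivity)]
    linarith
  nlinarith

/-- Accuracy of the gradient estimator computed from a fresh batch at a point that depends only
on the earlier batches. -/
lemma IsSplitCorruptedSample.measure_gradEstimate_error_le
    (h : IsSplitCorruptedSample μ P Z O T batch η) (h_labels : MeasurableSet labels)
    (h_loss : IsAdmissibleLoss labels loss) (hP : IsAdmissibleLaw labels P) (hΘ : IsCompact Θ)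
    (hσ : 0 < sigmaMax P loss Θ) (hm : Even m) (hm0 : 0 < m) (hη : 0 ≤ η) (hΛ : 23 / 10 ≤ Λ)
    (hα0 : 0 < α) (hα1 : α ≤ 1 / 2) (hαN : α * (m / 2) = 4 * (η * m) + 6 * Λ) {ε : ℝ}
    (hε : ε = 7 * sigmaMax P loss Θ * Real.sqrt (α / 2)) {t : ℕ} (ht : t < T)
    {X : Ω → E d} (hX : Measurable[pastSigma Z batch t] X) (hXΘ : ∀ w, X w ∈ Θ) :
    μ.real {w | ¬ ∀ j, |gradEstimate α loss (fun i => Z (batch t i) w) (X w) j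
        - meanGrad labels loss P (X w) j| ≤ ε} ≤ 4 * d * Real.exp (-Λ) := by
  have := hP.prob
  set σ := sigmaMax P loss Θ with hσdef
  set r := Real.sqrt α with hr
  have hr0 : 0 < r := Real.sqrt_pos.2 hα0
  have hr2 : r ^ 2 = α := Real.sq_sqrt hα0.le
  have hm' : (0 : ℝ) < m := by exact_mod_cast hm0
  set G := inlierIndices batch O t with hG
  have hGc := h.card_compl_le ht
  have hp : ∀ i ∈ G, batch t i ∉ O := fun i hi => (Finset.mem_filter.1 hi).2
  set good : ℝ → Fin d → Ω → Prop := fun ς j w => SideGood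
        ((firstHalf G).subtype fun i => batch t i ∉ O)
        ((secondHalf G).subtype fun i => batch t i ∉ O)
        (shortfallLevel P (centredCoord labels loss P ς j (X w)) (3 * (r * σ)))
        (2 * σ / r) (α * (m / 2) + 2) (α * (m / 2) - η * m - 2)
        (m / 2 * (3 * (r * σ) + 5 / 6 * (r * σ)))
        fun i => centredCoord labels loss P ς j (X w) (Z (batch t i) w) with hgood
  have hprob : ∀ ς : ℝ, ς ^ 2 = 1 → ∀ j, μ.real {w | ¬ good ς j w} ≤ 2 * Real.exp (-Λ) :=
    fun ς hς j => h.measure_not_sideGood_le h_labels h_loss hP hΘ hσ hm hη hΛ hα0 hα1 hαN ht hX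
      hXΘ hς j
  -- The measurable `gradCoord` agrees with the sample gradient for proper labels, which inliers
  -- have almost surely; nothing is required of the outliers.
  have hlab : ∀ᵐ w ∂μ, ∀ i ∉ O, (Z i w).2 ∈ labels := by
    rw [ae_all_iff]
    intro i
    by_cases hi : i ∈ O
    · exact Filter.Eventually.of_forall fun w hw => absurd hi hw
    · have h1 : ∀ᵐ z ∂(μ.map (Z i)), z.2 ∈ labels := by
        rw [h.inlier_law i hi]; exact hP.mem_labels
      filter_upwards [ae_of_ae_map (h.measurable i).aemeasurable h1] with w hw _ using hw
  -- The inliers contribute `3 + 5/6`. The outliers contribute `4 η σ / √α`, at most `√α σ / 2`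
  -- because `8 η ≤ α`. The total is `13/3`.
  have herr : 2 / (m : ℝ) * (m / 2 * (3 * (r * σ) + 5 / 6 * (r * σ)) + η * m * (2 * σ / r)) ≤ ε := by
    refine le_trans ?_ (sqrt_error_le hσ hα0 hε)
    have h1 : η * 8 ≤ r ^ 2 := by
      rw [hr2]
      have : η * 8 * (m / 2) ≤ α * (m / 2) := by rw [hαN]; linarith
      exact le_of_mul_le_mul_right this (by positivity)
    have h2 : 2 / (m : ℝ) * (m / 2 * (3 * (r * σ) + 5 / 6 * (r * σ)) + η * m * (2 * σ / r))
        = 23 / 6 * (r * σ) + η * 8 * (σ / (2 * r)) := by field_simp; ring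
    have h3 : η * 8 * (σ / (2 * r)) ≤ r ^ 2 * (σ / (2 * r)) := by gcongr
    have h4 : r ^ 2 * (σ / (2 * r)) = 1 / 2 * (r * σ) := by field_simp
    rw [h2, ← hr]
    linarith
  have hacc : ∀ w, (∀ i ∉ O, (Z i w).2 ∈ labels) → ∀ j, good 1 j w → good (-1) j w →
      |gradEstimate α loss (fun i => Z (batch t i) w) (X w) j
        - meanGrad labels loss P (X w) j| ≤ ε := by
    intro w hw j h1 h2
    set x : Fin m → ℝ := fun i => gradSample loss (X w) (Z (batch t i) w) j with hx
    set a := meanGrad labels loss P (X w) j with ha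
    have hB : 0 ≤ 2 * σ / r := by positivity
    have hlb : 23 / 10 ≤ α * (m / 2) := by
      rw [hαN]
      have : 0 ≤ η * m := by positivity
      linarith
    have hpf : ∀ i ∈ firstHalf G, batch t i ∉ O := fun i hi => hp i (Finset.mem_filter.1 hi).1
    have hps : ∀ i ∈ secondHalf G, batch t i ∉ O := fun i hi => hp i (Finset.mem_filter.1 hi).1
    have s1 := SideGood.of_subtype hpf hps
      (y := fun i => centredCoord labels loss P 1 j (X w) (Z (batch t i) w))
      (y' := fun i => x i - a) (fun i hi => by
        rw [centredCoord, one_mul, gradCoord_of_mem j (X w) (hw _ hi)]) h1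
    have s2 := SideGood.of_subtype hpf hps
      (y := fun i => centredCoord labels loss P (-1) j (X w) (Z (batch t i) w))
      (y' := fun i => a - x i) (fun i hi => by
        rw [centredCoord, gradCoord_of_mem j (X w) (hw _ hi)]; ring) h2
    -- The level is at most its shortfall `3 √α σ`, and `3 α ≤ 2`.
    have hbB : shortfallLevel P (centredCoord labels loss P (-1) j (X w)) (3 * (r * σ))
        ≤ 2 * σ / r := by
      refine (shortfallLevel_le (memLp_centredCoord h_labels h_loss hP _ j _)
        (integral_centredCoord h_labels h_loss hP _ j _) (by positivity)).trans ?_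
      rw [le_div_iff₀ hr0]
      nlinarith
    have u1 := trimmedMean_le hm hm0 hα1 hlb hGc hB s1
    have u2 := le_trimmedMean hm hm0 hα1 hlb hGc hB hbB s2
    change |trimmedMean α x - a| ≤ ε
    rw [abs_le]
    constructor <;> linarith
  have hnull : μ.real {w | ¬ ∀ i ∉ O, (Z i w).2 ∈ labels} = 0 := by
    rw [measureReal_def, ae_iff.1 hlab]; rfl
  have hsub : {w | ¬ ∀ j, |gradEstimate α loss (fun i => Z (batch t i) w) (X w) j
        - meanGrad labels loss P (X w) j| ≤ ε}
      ⊆ {w | ¬ ∀ i ∉ O, (Z i w).2 ∈ labels}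
        ∪ ⋃ j ∈ (Finset.univ : Finset (Fin d)), ({w | ¬ good 1 j w} ∪ {w | ¬ good (-1) j w}) := by
    intro w hw
    by_contra hn
    simp only [Set.mem_union, Set.mem_iUnion, Finset.mem_univ, exists_prop, true_and, not_or,
      not_exists, Set.mem_ofPred_eq, not_not] at hn
    exact hw fun j => hacc w hn.1 j (hn.2 j).1 (hn.2 j).2
  refine (measureReal_mono hsub).trans ((measureReal_union_le _ _).trans ?_)
  rw [hnull, zero_add]
  refine (measureReal_biUnion_finset_le _ _).trans ?_
  calc _ ≤ ∑ _j : Fin d, (2 * Real.exp (-Λ) + 2 * Real.exp (-Λ)) :=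
        Finset.sum_le_sum fun j _ => (measureReal_union_le _ _).trans
          (add_le_add (hprob 1 (by norm_num) j) (hprob (-1) (by norm_num) j))
    _ = _ := by
        rw [Finset.sum_const, Finset.card_univ, Fintype.card_fin, nsmul_eq_mul]
        ring

end Batch

end SparseMD

/-! ### Union bound over the iterations. -/

theorem mainTheorem3
    -- dimension, sparsity, parameter set
    (d : ℕ) (hd : 3 ≤ d)
    (Θ : Set (SparseMD.E d)) (hΘ_compact : IsCompact Θ) (hΘ_convex : Convex ℝ Θ)
    (s sbar : ℕ) (hs : s ≤ sbar) (hsbar : 1 ≤ sbar)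
    -- loss and distribution of the inliers
    (labels : Set ℝ) (h_labels : MeasurableSet labels)
    (loss : ℝ → ℝ → ℝ) (h_loss : SparseMD.IsAdmissibleLoss labels loss)
    (P : Measure (SparseMD.E d × ℝ)) (hP : SparseMD.IsAdmissibleLaw labels P)
    -- the sparse optimum and the quadratic growth condition
    (θstar : SparseMD.E d) (hθstar_mem : θstar ∈ Θ)
    (hθstar_min : IsMinOn (SparseMD.objective P loss) Θ θstar)
    (hθstar_sparse : SparseMD.sparsity θstar ≤ s)
    (κ : ℝ) (hκ : 0 < κ)
    (h_growth : ∀ θ ∈ Θ,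
      κ * ‖θ - θstar‖ ^ 2 ≤ SparseMD.objective P loss θ - SparseMD.objective P loss θstar)
    -- Lipschitz smoothness of the objective and step size
    (L : ℝ) (hL : 0 < L)
    (h_smooth : ∀ θ ∈ Θ, ∀ θ' ∈ Θ,
      SparseMD.linftyNorm (gradient (SparseMD.objective P loss) θ
        - gradient (SparseMD.objective P loss) θ') ≤ L * SparseMD.l1Norm (θ - θ'))
    (β : ℝ) (hβ : 0 < β) (hβL : β ≤ 1 / L)
    -- initialization and number of stages
    (θ₀ : SparseMD.E d) (hθ₀ : θ₀ ∈ Θ) (R : ℝ) (hR : 0 < R)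
    (hθstar_ball : θstar ∈ SparseMD.l1Ball θ₀ R)
    (K : ℕ) (hK : 1 ≤ K)
    -- number of iterations, batch size, confidence, corruption rate
    (T m : ℕ) (hm : Even m) (hm_pos : 0 < m) (δ δt η : ℝ) (hδ : 0 < δ) (hδ1 : δ < 1)
    (hδt : δt = δ / T) (hη : 0 ≤ η)
    (α : ℝ) (hα : α = 8 * η + 12 * (Real.log (4 / δt) + Real.log d) / m) (hα_half : α ≤ 1 / 2)
    (σ : ℝ) (hσ : σ = SparseMD.sigmaMax P loss Θ) (hσ_pos : 0 < σ)
    (ε : ℝ) (hε : ε = 7 * σ * Real.sqrt (4 * η + 6 * ((Real.log (4 / δt) + Real.log d) / m)))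
    (hT : SparseMD.stageStart d sbar R κ β ε K ≤ T)
    -- the corrupted data, split into batches
    {Ω : Type*} [MeasurableSpace Ω] (μ : Measure Ω) [IsProbabilityMeasure μ]
    (n : ℕ) (Z : Fin n → Ω → SparseMD.E d × ℝ) (O : Finset (Fin n)) (batch : ℕ → Fin m → Fin n)
    (h_data : SparseMD.IsSplitCorruptedSample μ P Z O T batch η)
    -- a run of AMMD, each iterate being a measurable function of the data used before it
    (θ : Ω → ℕ → ℕ → SparseMD.E d) (out : Ω → ℕ → SparseMD.E d)
    (h_run : ∀ w, SparseMD.IsAMMDRun Θ θ₀ sbar R κ β ε K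
      (fun t => SparseMD.gradEstimate α loss fun i => Z (batch t i) w) (θ w) (out w))
    (hθ_meas : ∀ k < K, ∀ t ≤ SparseMD.stageLength d sbar R κ β ε k,
      Measurable[SparseMD.pastSigma Z batch (SparseMD.stageStart d sbar R κ β ε k + t)]
        fun w => θ w k t)
    (hout_meas : ∀ k ≤ K,
      Measurable[SparseMD.pastSigma Z batch (SparseMD.stageStart d sbar R κ β ε k)]
        fun w => out w k) :
    1 - δ ≤ μ.real {w | ‖out w K - θstar‖ ≤
      (2 : ℝ) ^ (-(K : ℝ) / 2) * R / Real.sqrt sbar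
        + 140 * Real.sqrt (2 * sbar) * σ / κ
          * Real.sqrt (4 * η + 6 * ((Real.log (4 / δt) + Real.log d) / m))} := by
  have hP1 := hP.prob
  have hl := SparseMD.one_lt_log hd
  have hm' : (0 : ℝ) < m := by exact_mod_cast hm_pos
  have hd0 : (0 : ℝ) < d := by positivity
  -- With `log d > 1` this gives `Λ ≥ 23/10`, the absolute lower bound used in the Chernoff
  -- estimates.
  have hlog4 : 13 / 10 ≤ Real.log 4 := by
    rw [show (4 : ℝ) = 2 ^ 2 by norm_num, Real.log_pow]
    have := Real.log_two_gt_d9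
    push_cast
    linarith
  set Λ := Real.log (4 / δt) + Real.log d with hΛdef
  -- Positivity of `T` will follow from that of the stage lengths, hence of `ε`, hence of `Λ`. To
  -- avoid circularity `T = 0` is carried along: there `δt = 0`, the logarithm takes its default
  -- value `0`, and `Λ = log d` is still positive.
  have hTδ : Real.log 4 ≤ Real.log (4 / δt) ∨ T = 0 := by
    rcases Nat.eq_zero_or_pos T with h | h
    · exact Or.inr h
    · left
      have hT1 : (1 : ℝ) ≤ T := by exact_mod_cast h
      have h0 : 0 < δt := by rw [hδt]; positivity
      have h1 : δt ≤ 1 := by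
        rw [hδt, div_le_one (by positivity)]
        linarith
      refine Real.log_le_log (by norm_num) ?_
      rw [le_div_iff₀ h0]
      linarith
  have hΛpos : 0 < Λ := by
    rcases hTδ with h | h
    · rw [hΛdef]; linarith
    · rw [hΛdef, hδt, h]; simp; linarith
  have hα' : 4 * η + 6 * (Λ / m) = α / 2 := by rw [hα]; ring
  have hα0 : 0 < α := by
    have : 0 < Λ / m := by positivity
    linarith
  rw [hα'] at hε ⊢
  have hε0 : 0 < ε := by
    rw [hε]
    have : 0 < Real.sqrt (α / 2) := Real.sqrt_pos.2 (by positivity)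
    positivity
  have hlen : ∀ k, 0 < SparseMD.stageLength d sbar R κ β ε k := fun k => by
    have h1 := SparseMD.stageRadius_pos (sbar := sbar) hR hκ hε0.le k
    have h2 : 0 < SparseMD.dgfGrowth d := by unfold SparseMD.dgfGrowth; positivity
    exact Nat.ceil_pos.2 (by positivity)
  have hT0 : 0 < T := by
    refine lt_of_lt_of_le ?_ hT
    exact Finset.sum_pos (fun k _ => hlen k) (Finset.nonempty_range_iff.2 (by omega))
  have hT0' : (0 : ℝ) < T := by exact_mod_cast hT0
  have hδt0 : 0 < δt := by rw [hδt]; positivity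
  have hΛ : 23 / 10 ≤ Λ := by
    rcases hTδ with h | h
    · rw [hΛdef]; linarith
    · omega
  have hexp : 4 * d * Real.exp (-Λ) = δt := by
    rw [hΛdef, Real.exp_neg, Real.exp_add, Real.exp_log (by positivity), Real.exp_log hd0]
    field_simp
  have hαN : α * (m / 2) = 4 * (η * m) + 6 * Λ := by
    rw [hα]; field_simp; ring
  have hgrad : ∀ x, HasGradientAt (SparseMD.objective P loss) (SparseMD.meanGrad labels loss P x) x :=
    fun x => SparseMD.hasGradientAt_objective h_labels h_loss hP x
  set bad : ℕ → ℕ → Set Ω := fun k t => {w | ¬ ∀ j,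
    |SparseMD.gradEstimate α loss
        (fun i => Z (batch (SparseMD.stageStart d sbar R κ β ε k + t) i) w) (θ w k t) j
      - SparseMD.meanGrad labels loss P (θ w k t) j| ≤ ε} with hbad
  have hidx : ∀ k < K, ∀ t < SparseMD.stageLength d sbar R κ β ε k,
      SparseMD.stageStart d sbar R κ β ε k + t < T := by
    intro k hk t ht
    refine lt_of_lt_of_le ?_ hT
    have h1 : SparseMD.stageStart d sbar R κ β ε (k + 1)
        ≤ SparseMD.stageStart d sbar R κ β ε K :=
      Finset.sum_le_sum_of_subset (Finset.range_mono hk)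
    have h2 : SparseMD.stageStart d sbar R κ β ε (k + 1) = SparseMD.stageStart d sbar R κ β ε k
        + SparseMD.stageLength d sbar R κ β ε k := Finset.sum_range_succ _ _
    omega
  have hbadle : ∀ k < K, ∀ t < SparseMD.stageLength d sbar R κ β ε k,
      μ.real (bad k t) ≤ δt := by
    intro k hk t ht
    rw [← hexp]
    exact h_data.measure_gradEstimate_error_le h_labels h_loss hP hΘ_compact (hσ ▸ hσ_pos) hm
      hm_pos hη hΛ hα0 hα_half hαN (hσ ▸ hε) (hidx k hk t ht) (hθ_meas k hk t ht.le)
      fun w => (h_run w).iterate_mem hθ₀ hk ht.le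
  set target : Set Ω := {w | ‖out w K - θstar‖ ≤
      (2 : ℝ) ^ (-(K : ℝ) / 2) * R / Real.sqrt sbar
        + 140 * Real.sqrt (2 * sbar) * σ / κ * Real.sqrt (α / 2)} with htarget
  set B : Set Ω := ⋃ k ∈ Finset.range K,
    ⋃ t ∈ Finset.range (SparseMD.stageLength d sbar R κ β ε k), bad k t with hB
  have hcover : (Set.univ : Set Ω) ⊆ target ∪ B := by
    intro w _
    by_cases hw : w ∈ B
    · exact Or.inr hw
    · left
      simp only [hB, Set.mem_iUnion, Finset.mem_range, exists_prop, not_exists, not_and] at hw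
      have h1 := (h_run w).norm_sub_le hd hΘ_convex hgrad
        (fun x y => SparseMD.objective_tangent_le h_labels h_loss hP x y) hL
        (fun x hx y hy => by
          rw [← (hgrad x).gradient, ← (hgrad y).gradient]; exact h_smooth x hx y hy)
        hβ hβL hε0 hR hκ hθ₀ hθstar_mem hsbar (hθstar_sparse.trans hs) h_growth hθstar_ball hK
        (fun k hk t ht => not_not.1 (hw k hk t ht))
      refine h1.trans ((SparseMD.stageRadius_div_sqrt_le hsbar hR hκ hε0.le).trans_eq ?_)
      rw [hε]
      ring
  have hBle : μ.real B ≤ δ := by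
    calc μ.real B ≤ ∑ k ∈ Finset.range K, μ.real
          (⋃ t ∈ Finset.range (SparseMD.stageLength d sbar R κ β ε k), bad k t) :=
          measureReal_biUnion_finset_le _ _
      _ ≤ ∑ k ∈ Finset.range K, ∑ t ∈ Finset.range (SparseMD.stageLength d sbar R κ β ε k), δt :=
          Finset.sum_le_sum fun k hk => (measureReal_biUnion_finset_le _ _).trans
            (Finset.sum_le_sum fun t ht =>
              hbadle k (Finset.mem_range.1 hk) t (Finset.mem_range.1 ht))
      _ = SparseMD.stageStart d sbar R κ β ε K * δt := by
          simp [SparseMD.stageStart, Finset.sum_mul]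
      _ ≤ T * δt := by
          have : (SparseMD.stageStart d sbar R κ β ε K : ℝ) ≤ T := by exact_mod_cast hT
          gcongr
      _ = δ := by rw [hδt]; field_simp
  -- Subadditivity on a cover of the whole space, rather than passage to a complement, so that
  -- neither event has to be measurable.
  have h1 : (1 : ℝ) ≤ μ.real target + μ.real B := by
    rw [← probReal_univ (μ := μ)]
    exact (measureReal_mono hcover).trans (measureReal_union_le _ _)
  linarith
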